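/- A \emph{Scott domain} is a partial order with least element $\bot$ that is directed complete, bounded complete (every subset with an upper bound has a least upper bound) and $\omega$-algebraic (there are countably many compact elements, and every $x$ is the directed supremum of the compact elements below it). Let $\mathbf{StrictBcdom}$ be the category of Scott domains and strict continuous functions, i.e. functions that preserve suprema of nonempty directed sets and preserve $\bot$. A \emph{linear category} is a symmetric monoidal closed category $(\mathcal L,\otimes,\mathbf 1,\multimap)$ with a comonad $(!,\delta,\varepsilon)$ such that: $!$ is a symmetric monoidal functor, with structure maps $q_{\mathbf 1}:\mathbf 1\to{!\mathbf 1}$ and $q_{A,B}:{!A}\otimes{!B}\to{!(A\otimes B)}$, and $\delta,\varepsilon$ are monoidal natural transformations; there are monoidal natural transformations $d_A:{!A}\to{!A}\otimes{!A}$ and $e_A:{!A}\to\mathbf 1$ that make each $!A$ a commutative comonoid and are $!$-coalgebra morphisms on the free coalgebra $(!A,\delta_A)$; and every coalgebra morphism between free coalgebras is a comonoid morphism. An \emph{$\mathcal S\ell\lambda$-category} is a linear category together with: (1) an exponential object of numerals, i.e. a $!$-coalgebra $(N,p)$ with maps $0:\mathbf 1\to N$, $succ:N\to N$, $pred:N\to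 N$ such that $pred\circ \underline{n+1}=\underline n$ for all $n$ (where $\underline 0=0$ and $\underline{n+1}=succ\circ\underline n$), and a commutative comonoid structure $w_N:N\to\mathbf 1$, $c_N:N\to N\otimes N$, such that $0$ and $succ$ are both coalgebra and comonoid morphisms and $p:N\to{!N}$ is a comonoid morphism; (2) finite products, and a morphism $\ell if:N\otimes(N\times N)\to N$ such that for all $f,g:\mathbf 1\to N$ and $n\ge 0$, modulo $\mathbf 1\cong\mathbf 1\otimes\mathbf 1$, $\ell if\circ(\underline 0\otimes\langle f,g\rangle)=f$ and $\ell if\circ(\underline{n+1}\otimes\langle f,g\rangle)=g$; (3) fixpoint operators in the co-Kleisli category of $!$ (which is cartesian closed), i.e. for each object $B$ a morphism $fix_B:{!(!B\multimap B)}\to B$ with $fix_B=\mathrm{eval}\circ(\varepsilon\otimes({!fix_B}\circ\delta))\circ d$. \textbf{Theorem.} $\mathbf{StrictBcdom}$ is an $\mathcal S\ell\lambda$-category, with the following structure (up to order isomorphism of the objects; all maps send $\bot$ to $\bot$). $A\otimes B$ is the smash product $\{\langle a,b\rangle\mid a\ne\bot,\ b\ne\bot\}\cup\{\bot\}$, where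 we put $\langle a,b\rangle=\bot$ if $a=\bot$ or $b=\bot$, with tensor of morphisms $(f\otimes g)\langle a,b\rangle=\langle f(a),g(b)\rangle$; $\mathbf 1$ is the Sierpi\'nski domain $\{\bot\le\top\}$; the associator, unitors and symmetry are $\langle\langle a,b\rangle,c\rangle\mapsto\langle a,\langle b,c\rangle\rangle$, $\langle\top,a\rangle\mapsto a$, $\langle a,\top\rangle\mapsto a$, $\langle a,b\rangle\mapsto\langle b,a\rangle$. $A\multimap B$ is the set of strict continuous functions with the pointwise order, with evaluation $\langle f,a\rangle\mapsto f(a)$. $!A=A_\bot=\{\mathrm{up}(a)\mid a\in A\}\cup\{\bot\}$ is $A$ with a new least element, with ${!f}(\mathrm{up}(a))=\mathrm{up}(f(a))$, $\varepsilon(\mathrm{up}(a))=a$, $\delta(\mathrm{up}(a))=\mathrm{up}(\mathrm{up}(a))$, $q_{\mathbf 1}(\top)=\mathrm{up}(\top)$, $q\langle\mathrm{up}(a),\mathrm{up}(b)\rangle=\mathrm{up}(\langle a,b\rangle)$, $d(\mathrm{up}(a))=\langle\mathrm{up}(a),\mathrm{up}(a)\rangle$, $e(\mathrm{up}(a))=\top$.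 The categorical product is the cartesian product with the componentwise order and the usual projections. $N$ is the flat domain of natural numbers, with $0(\top)=0$, $succ(n)=n+1$, $pred(n+1)=n$, $p(n)=\mathrm{up}(n)$, $w_N(n)=\top$, $c_N(n)=\langle n,n\rangle$. The conditional is $\ell if\langle 0,(m_1,m_2)\rangle=m_1$ and $\ell if\langle n+1,(m_1,m_2)\rangle=m_2$. Finally $fix_B(\mathrm{up}(f))$ is the least $b\in B$ with $f(\mathrm{up}(b))=b$. -/

import Mathlib

open CategoryTheory MonoidalCategory

universe v u

namespace SlLambda

/-! ## Linear categories and `Sℓλ`-categories -/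

section Categorical

variable (C : Type u) [Category.{v} C] [MonoidalCategory C] [SymmetricCategory C]

/-- A linear category (Benton, Bierman, Hyland, de Paiva): a symmetric monoidal closed category
with an exponential comonad. Composition is written in diagrammatic order. -/
class LinearCategory [MonoidalClosed C] where
  /-- The comonad `(!, δ, ε)`. -/
  bang : Comonad C
  /-- `!` is a (lax) symmetric monoidal functor; its structure maps are `q_𝟙 : 𝟙 ⟶ !𝟙` and
  `q_{A,B} : !A ⊗ !B ⟶ !(A ⊗ B)`. -/
  [lax : bang.toFunctor.LaxBraided]
  /-- `ε` and `δ` are monoidal natural transformations. -/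
  ε_monoidal : NatTrans.IsMonoidal bang.ε
  δ_monoidal : NatTrans.IsMonoidal bang.δ
  /-- `d_A : !A ⟶ !A ⊗ !A` (comultiplication) and `e_A : !A ⟶ 𝟙` (counit) form a comonoid ... -/
  [comon : ∀ A : C, ComonObj (bang.obj A)]
  /-- ... which is commutative. -/
  comm : ∀ A : C, IsCommComonObj (bang.obj A)
  /-- `d` and `e` are natural transformations ... -/
  d_natural : ∀ {A B : C} (f : A ⟶ B),
    bang.map f ≫ ComonObj.comul (X := bang.obj B) =
      ComonObj.comul (X := bang.obj A) ≫ (bang.map f ⊗ₘ bang.map f)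
  e_natural : ∀ {A B : C} (f : A ⟶ B),
    bang.map f ≫ ComonObj.counit (X := bang.obj B) = ComonObj.counit (X := bang.obj A)
  /-- ... and monoidal ones, from `!` to `A ↦ !A ⊗ !A` and to the constant functor `𝟙`. -/
  d_unit : Functor.LaxMonoidal.ε bang.toFunctor ≫ ComonObj.comul (X := bang.obj (𝟙_ C)) =
    (λ_ (𝟙_ C)).inv ≫
      (Functor.LaxMonoidal.ε bang.toFunctor ⊗ₘ Functor.LaxMonoidal.ε bang.toFunctor)
  d_tensor : ∀ A B : C,
    Functor.LaxMonoidal.μ bang.toFunctor A B ≫ ComonObj.comul (X := bang.obj (A ⊗ B)) =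
      (ComonObj.comul (X := bang.obj A) ⊗ₘ ComonObj.comul (X := bang.obj B)) ≫
        tensorμ (bang.obj A) (bang.obj A) (bang.obj B) (bang.obj B) ≫
          (Functor.LaxMonoidal.μ bang.toFunctor A B ⊗ₘ Functor.LaxMonoidal.μ bang.toFunctor A B)
  e_unit : Functor.LaxMonoidal.ε bang.toFunctor ≫ ComonObj.counit (X := bang.obj (𝟙_ C)) =
    𝟙 (𝟙_ C)
  e_tensor : ∀ A B : C,
    Functor.LaxMonoidal.μ bang.toFunctor A B ≫ ComonObj.counit (X := bang.obj (A ⊗ B)) =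
      (ComonObj.counit (X := bang.obj A) ⊗ₘ ComonObj.counit (X := bang.obj B)) ≫ (λ_ (𝟙_ C)).hom
  /-- `d_A` and `e_A` are coalgebra morphisms from `(!A, δ_A)` to
  `(!A ⊗ !A, q ∘ (δ_A ⊗ δ_A))` and to `(𝟙, q_𝟙)`. -/
  d_coalgebra : ∀ A : C,
    bang.δ.app A ≫ bang.map (ComonObj.comul (X := bang.obj A)) =
      ComonObj.comul (X := bang.obj A) ≫ (bang.δ.app A ⊗ₘ bang.δ.app A) ≫
        Functor.LaxMonoidal.μ bang.toFunctor (bang.obj A) (bang.obj A)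
  e_coalgebra : ∀ A : C,
    bang.δ.app A ≫ bang.map (ComonObj.counit (X := bang.obj A)) =
      ComonObj.counit (X := bang.obj A) ≫ Functor.LaxMonoidal.ε bang.toFunctor
  /-- Coalgebra morphisms between free coalgebras are comonoid morphisms. -/
  comonHom_of_coalgebraHom : ∀ {A B : C} (f : bang.obj A ⟶ bang.obj B),
    bang.δ.app A ≫ bang.map f = f ≫ bang.δ.app B → IsComonHom f

attribute [reducible, instance] LinearCategory.lax LinearCategory.comon

variable {C}

/-- The numerals `n : 𝟙 ⟶ N` generated by `0 : 𝟙 ⟶ N` and `succ : N ⟶ N`. -/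
def numeral {N : C} (zero : 𝟙_ C ⟶ N) (succ : N ⟶ N) : ℕ → (𝟙_ C ⟶ N)
  | 0 => zero
  | n + 1 => numeral zero succ n ≫ succ

/-- Evaluation `(A ⊸ B) ⊗ A ⟶ B`. -/
def eval [MonoidalClosed C] (A B : C) : (ihom A).obj B ⊗ A ⟶ B :=
  (β_ ((ihom A).obj B) A).hom ≫ (ihom.ev A).app B

variable (C)

attribute [local instance] ComonObj.instTensorUnit

open LinearCategory in
/-- An `Sℓλ`-category: a linear category with an exponential object of numerals, finite products,
a conditional and fixpoint operators. -/
class SlLambdaCategory [MonoidalClosed C] [LinearCategory C] where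
  /-- The `!`-coalgebra `(N, p)`. -/
  num : (bang (C := C)).Coalgebra
  zero : 𝟙_ C ⟶ num.A
  succ : num.A ⟶ num.A
  pred : num.A ⟶ num.A
  numeral_pred : ∀ n : ℕ, numeral zero succ (n + 1) ≫ pred = numeral zero succ n
  /-- `w_N` (counit) and `c_N` (comultiplication) form a commutative comonoid. -/
  [numComon : ComonObj num.A]
  numComm : IsCommComonObj num.A
  /-- `0` and `succ` are coalgebra morphisms, where `𝟙` carries the coalgebra structure `q_𝟙` ... -/
  zero_coalgebra : Functor.LaxMonoidal.ε (bang (C := C)).toFunctor ≫ bang.map zero = zero ≫ num.a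
  succ_coalgebra : num.a ≫ bang.map succ = succ ≫ num.a
  /-- ... and comonoid morphisms, where `𝟙` carries the trivial comonoid structure. -/
  zero_comon : IsComonHom zero
  succ_comon : IsComonHom succ
  /-- `p : N ⟶ !N` is a comonoid morphism. -/
  p_comon : IsComonHom (M := num.A) (N := bang.obj num.A) num.a
  /-- `C` is cartesian: binary products and a terminal object. -/
  fan : ∀ A B : C, Limits.BinaryFan A B
  fanIsLimit : ∀ A B : C, Limits.IsLimit (fan A B)
  top : C
  topIsTerminal : Limits.IsTerminal top
  /-- The conditional. -/
  lif : num.A ⊗ (fan num.A num.A).pt ⟶ num.A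
  lif_zero : ∀ f g : 𝟙_ C ⟶ num.A,
    (λ_ (𝟙_ C)).inv ≫
      (numeral zero succ 0 ⊗ₘ Limits.BinaryFan.IsLimit.lift (fanIsLimit num.A num.A) f g) ≫ lif = f
  lif_succ : ∀ (n : ℕ) (f g : 𝟙_ C ⟶ num.A),
    (λ_ (𝟙_ C)).inv ≫
      (numeral zero succ (n + 1) ⊗ₘ
        Limits.BinaryFan.IsLimit.lift (fanIsLimit num.A num.A) f g) ≫ lif = g
  /-- The co-Kleisli category of `!` is cartesian closed. -/
  kleisli_cartesianClosed : ∃ _ : CartesianMonoidalCategory (Cokleisli (bang (C := C))),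
    Nonempty (MonoidalClosed (Cokleisli (bang (C := C))))
  /-- The fixpoint operators. -/
  fix : ∀ B : C, bang.obj ((ihom (bang.obj B)).obj B) ⟶ B
  fix_eq : ∀ B : C, fix B =
    ComonObj.comul (X := bang.obj ((ihom (bang.obj B)).obj B)) ≫
      (bang.ε.app ((ihom (bang.obj B)).obj B) ⊗ₘ
        (bang.δ.app ((ihom (bang.obj B)).obj B) ≫ bang.map (fix B))) ≫
      eval (bang.obj B) B

attribute [reducible, instance] SlLambdaCategory.numComon

end Categorical

/-! ## Scott domains and strict continuous functions -/

/-- Scott domains: `ω`-algebraic bounded complete (directed complete) partial orders. -/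
structure IsScottDomain (D : Type u) [PartialOrder D] [OrderBot D] : Prop where
  directedComplete : ∀ s : Set D, s.Nonempty → DirectedOn (· ≤ ·) s → ∃ x, IsLUB s x
  boundedComplete : ∀ s : Set D, BddAbove s → ∃ x, IsLUB s x
  algebraic_directed : ∀ x : D, DirectedOn (· ≤ ·) {k | IsCompactElement k ∧ k ≤ x}
  algebraic_isLUB : ∀ x : D, IsLUB {k | IsCompactElement k ∧ k ≤ x} x
  countable_compact : {k : D | IsCompactElement k}.Countable

/-- Strict Scott-continuous functions. -/
@[ext]
structure StrictMap (A B : Type u) [PartialOrder A] [OrderBot A] [PartialOrder B] [OrderBot B] where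
  toFun : A → B
  continuous' : ScottContinuous toFun
  strict' : toFun ⊥ = ⊥

namespace StrictMap

variable {A B D : Type u} [PartialOrder A] [OrderBot A] [PartialOrder B] [OrderBot B]
  [PartialOrder D] [OrderBot D]

instance : FunLike (StrictMap A B) A B where
  coe := toFun
  coe_injective _ _ h := StrictMap.ext h

/-- The pointwise order. -/
instance : PartialOrder (StrictMap A B) :=
  PartialOrder.lift (fun f a => f a) DFunLike.coe_injective

/-- The identity. -/
def id (A : Type u) [PartialOrder A] [OrderBot A] : StrictMap A A where
  toFun a := a
  continuous' := ScottContinuous.id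
  strict' := rfl

/-- Composition, `g` after `f`. -/
def comp (g : StrictMap B D) (f : StrictMap A B) : StrictMap A D where
  toFun a := g (f a)
  continuous' := ScottContinuous.comp f.continuous' g.continuous'
  strict' := (congrArg g f.strict').trans g.strict'

end StrictMap

/-- The objects of the category of Scott domains and strict continuous functions. -/
structure StrictBcdom where
  carrier : Type u
  [order : PartialOrder carrier]
  [bot : OrderBot carrier]
  isScottDomain : IsScottDomain carrier

namespace StrictBcdom

instance : CoeSort StrictBcdom.{u} (Type u) := ⟨carrier⟩

attribute [instance] order bot

/-- The category of Scott domains and strict continuous functions. -/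
instance : Category.{u} StrictBcdom.{u} where
  Hom A B := StrictMap A B
  id A := StrictMap.id A
  comp f g := StrictMap.comp g f

instance : ConcreteCategory StrictBcdom.{u} (fun A B => StrictMap A B) where
  hom f := f
  ofHom f := f

end StrictBcdom

/-! ## The concrete constructions -/

/-- The smash product of pointed posets: pairs of non-bottom elements, ordered componentwise, with
a new least element. -/
abbrev Smash (A B : Type u) [PartialOrder A] [OrderBot A] [PartialOrder B] [OrderBot B] : Type u :=
  WithBot ({a : A // a ≠ ⊥} × {b : B // b ≠ ⊥})

open Classical in
/-- The pair `⟨a, b⟩` in the smash product; it is `⊥` if `a = ⊥` or `b = ⊥`. -/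
noncomputable def smashPair {A B : Type u} [PartialOrder A] [OrderBot A] [PartialOrder B]
    [OrderBot B] (a : A) (b : B) : Smash A B :=
  if h : a ≠ ⊥ ∧ b ≠ ⊥ then WithBot.some (⟨a, h.1⟩, ⟨b, h.2⟩) else ⊥

/-- The flat domain of natural numbers. -/
inductive FlatNat : Type
  | bot : FlatNat
  | nat : ℕ → FlatNat

instance : PartialOrder FlatNat where
  le x y := x = FlatNat.bot ∨ x = y
  le_refl _ := Or.inr rfl
  le_trans := by rintro x y z (h | rfl) (h' | rfl) <;> simp_all
  le_antisymm := by rintro x y (h | h) (h' | h') <;> simp_all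

open LinearCategory SlLambdaCategory in
/-- Identifications of the objects provided by an `Sℓλ`-structure on the category of Scott domains
with the concrete domains, as ordered sets. -/
structure Carriers [MonoidalCategory StrictBcdom.{u}] [SymmetricCategory StrictBcdom.{u}]
    [MonoidalClosed StrictBcdom.{u}] [LinearCategory StrictBcdom.{u}]
    [SlLambdaCategory StrictBcdom.{u}] where
  /-- The tensor product is the smash product. -/
  tensor : ∀ A B : StrictBcdom.{u}, (A ⊗ B : StrictBcdom.{u}) ≃o Smash A B
  /-- The tensor unit is the Sierpinski domain. -/
  unit : (𝟙_ StrictBcdom.{u}) ≃o Bool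
  /-- The internal hom is the set of strict continuous functions with the pointwise order. -/
  hom : ∀ A B : StrictBcdom.{u}, ((ihom A).obj B) ≃o StrictMap A B
  /-- `!A` is the lifting of `A`, that is `A` with a new least element. -/
  lift : ∀ A : StrictBcdom.{u}, ((bang (C := StrictBcdom.{u})).obj A) ≃o WithBot A
  /-- The categorical product is the cartesian product. -/
  prod : ∀ A B : StrictBcdom.{u}, ((fan A B).pt) ≃o A × B
  /-- The object of numerals is the flat domain of natural numbers. -/
  nat : ((num (C := StrictBcdom.{u})).A) ≃o FlatNat

namespace Carriers

open LinearCategory SlLambdaCategory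

variable [MonoidalCategory StrictBcdom.{u}] [SymmetricCategory StrictBcdom.{u}]
  [MonoidalClosed StrictBcdom.{u}] [LinearCategory StrictBcdom.{u}]
  [SlLambdaCategory StrictBcdom.{u}] (K : Carriers.{u})

/-- The element `⟨a, b⟩` of `A ⊗ B`. -/
noncomputable def pair {A B : StrictBcdom.{u}} (a : A) (b : B) : (A ⊗ B : StrictBcdom.{u}) :=
  (K.tensor A B).symm (smashPair a b)

/-- The element `⊤` of the tensor unit. -/
def star : (𝟙_ StrictBcdom.{u} : StrictBcdom.{u}) := K.unit.symm true

/-- The copy of `a : A` in `!A`. -/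
def up {A : StrictBcdom.{u}} (a : A) : (bang (C := StrictBcdom.{u})).obj A :=
  (K.lift A).symm (WithBot.some a)

/-- The element `⟨a, b⟩` of the categorical product. -/
def couple {A B : StrictBcdom.{u}} (a : A) (b : B) : (fan A B).pt := (K.prod A B).symm (a, b)

/-- The number `n` as an element of the object of numerals. -/
def ofNat (n : ℕ) : (num (C := StrictBcdom.{u})).A := K.nat.symm (FlatNat.nat n)

end Carriers

end SlLambda

/-! All objects and maps are built concretely, and each categorical law is checked on generating
elements. A strict map out of `!A` is the same thing as a continuous function on `A`, a strict map
out of `A ⊗ B` is a continuous function of two variables that is strict in each, and maps out of `𝟙`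
and `N` are fixed by their values at `⊤` and at the numerals (`bang_hom_ext`, `tensor_hom_ext`,
`unit_hom_ext`, `nat_hom_ext`). Most laws thereby become short computations.

The order theory has two pillars. `IsScottDomain.of_basis` avoids determining the compact elements:
a countable supply of compact elements that generates under suprema is enough. The adjunction
`smashSplit_gc` exhibits the smash product as a retract of the cartesian product, from which suprema
and continuity are transported. For function spaces the basis consists of step functions.

The comonoids are diagonals. Every strict map respects `a ↦ ⟨a, a⟩`, and it respects the counit when
it reflects `⊥`. A coalgebra map `f : !A ⟶ !B` does so: if `f (up a) = ⊥`, then its coalgebra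
equation at `up a` reads `up ⊥ = ⊥`, which is false. The co-Kleisli category is that of all
continuous functions, with exponential `!X ⊸ Z`. The fixpoint operator is Kleene's, continuous as a
pointwise supremum of the finite iterates. -/

namespace SlLambda

/-! ## Order theory -/

section OrderTheory

/-- A pointwise least upper bound of Scott continuous functions is Scott continuous. -/
lemma scottContinuous_of_isLUB {A B : Type*} [Preorder A] [Preorder B] {F : Set (A → B)}
    {h : A → B} (hF : ∀ g ∈ F, ScottContinuous g)
    (hh : ∀ x, IsLUB ((fun g => g x) '' F) (h x)) : ScottContinuous h := by
  intro d hd hdir x hx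
  have le : ∀ g ∈ F, ∀ y, g y ≤ h y := fun g hg y => (hh y).1 ⟨g, hg, rfl⟩
  refine ⟨?_, fun w hw => (hh x).2 ?_⟩
  · rintro _ ⟨y, hy, rfl⟩
    refine (hh y).2 ?_
    rintro _ ⟨g, hg, rfl⟩
    exact ((hF g hg).monotone (hx.1 hy)).trans (le g hg x)
  · rintro _ ⟨g, hg, rfl⟩
    refine (hF g hg hd hdir hx).2 ?_
    rintro _ ⟨y, hy, rfl⟩
    exact (le g hg y).trans (hw ⟨y, hy, rfl⟩)

/-- The new bottom element never affects a supremum, except that a set without lifted elements has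
supremum `⊥` and not the lifting of a least element. Hence the nonemptiness condition. -/
lemma isLUB_coe_of_preimage {A : Type*} [PartialOrder A] {s : Set (WithBot A)} {a : A}
    (hs : (WithBot.some ⁻¹' s).Nonempty) (h : IsLUB (WithBot.some ⁻¹' s) a) :
    IsLUB s (a : WithBot A) := by
  obtain ⟨b, hb⟩ := hs
  refine ⟨fun x hx => ?_, fun w hw => ?_⟩
  · induction x with
    | bot => exact bot_le
    | coe x => exact WithBot.coe_le_coe.2 (h.1 hx)
  · have hbw := hw hb
    induction w with
    | bot => exact absurd hbw (by simp)
    | coe w => exact WithBot.coe_le_coe.2 (h.2 fun x hx => WithBot.coe_le_coe.1 (hw hx))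

lemma isLUB_preimage_of_coe {A : Type*} [PartialOrder A] {s : Set (WithBot A)} {a : A}
    (h : IsLUB s (a : WithBot A)) :
    (WithBot.some ⁻¹' s).Nonempty ∧ IsLUB (WithBot.some ⁻¹' s) a := by
  refine ⟨?_, fun x hx => WithBot.coe_le_coe.1 (h.1 hx), fun w hw => WithBot.coe_le_coe.1 (h.2 ?_)⟩
  · by_contra hne
    have : (a : WithBot A) ≤ ⊥ := h.2 fun x hx => by
      induction x with
      | bot => exact bot_le
      | coe x => exact absurd ⟨x, hx⟩ hne
    simp at this
  · intro x hx
    induction x with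
    | bot => exact bot_le
    | coe x => exact WithBot.coe_le_coe.2 (hw hx)

lemma isLUB_bot_of_preimage {A : Type*} [PartialOrder A] {s : Set (WithBot A)}
    (hs : ¬ (WithBot.some ⁻¹' s).Nonempty) : IsLUB s (⊥ : WithBot A) := by
  refine ⟨fun x hx => ?_, fun _ _ => bot_le⟩
  induction x with
  | bot => exact le_rfl
  | coe x => exact absurd ⟨x, hx⟩ hs

lemma directedOn_preimage_coe {A : Type*} [PartialOrder A] {s : Set (WithBot A)}
    (hs : DirectedOn (· ≤ ·) s) : DirectedOn (· ≤ ·) (WithBot.some ⁻¹' s : Set A) := by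
  intro a ha b hb
  obtain ⟨c, hc, hac, hbc⟩ := hs _ ha _ hb
  induction c with
  | bot => exact absurd hac (by simp)
  | coe c => exact ⟨c, hc, WithBot.coe_le_coe.1 hac, WithBot.coe_le_coe.1 hbc⟩

/-- The inclusion is continuous without being strict, since continuity concerns nonempty directed
sets only. -/
lemma scottContinuous_coe {A : Type*} [PartialOrder A] :
    ScottContinuous (WithBot.some : A → WithBot A) := by
  intro d hd _ a ha
  have h : (WithBot.some ⁻¹' (WithBot.some '' d) : Set A) = d :=
    Set.preimage_image_eq d WithBot.coe_injective
  exact isLUB_coe_of_preimage (by rwa [h]) (by rwa [h])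

/-! ### Scott domains from countable bases -/

variable {A B D : Type u} [PartialOrder A] [OrderBot A] [PartialOrder B] [OrderBot B]
  [PartialOrder D] [OrderBot D]

lemma isLUB_exists_ne_bot {s : Set A} {a : A} (h : IsLUB s a) (ha : a ≠ ⊥) :
    ∃ x ∈ s, x ≠ ⊥ := by
  by_contra hne
  push Not at hne
  exact ha (le_bot_iff.1 (h.2 fun x hx => (hne x hx).le))

lemma isCompactElement_bot : IsCompactElement (⊥ : A) :=
  fun _ _ ⟨x, hx⟩ _ _ _ => ⟨x, hx, bot_le⟩

/-- A directed complete and bounded complete partial order in which every element is the least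
upper bound of the elements below it from a countable set of compact elements is a Scott domain. -/
lemma IsScottDomain.of_basis (dc : ∀ s : Set D, s.Nonempty → DirectedOn (· ≤ ·) s → ∃ x, IsLUB s x)
    (bc : ∀ s : Set D, BddAbove s → ∃ x, IsLUB s x) (S : Set D) (hS : S.Countable)
    (hc : ∀ k ∈ S, IsCompactElement k) (hlub : ∀ x, IsLUB {k | k ∈ S ∧ k ≤ x} x) :
    IsScottDomain D where
  directedComplete := dc
  boundedComplete := bc
  algebraic_directed x := by
    rintro a ⟨ha, hax⟩ b ⟨hb, hbx⟩
    -- The join of two compact elements below `x` exists by bounded completeness. It is compact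
    -- because a directed set with a member above `a` and one above `b` has a member above both.
    obtain ⟨c, hab⟩ := bc {a, b} ⟨x, by rintro _ (rfl | rfl) <;> assumption⟩
    refine ⟨c, ⟨?_, hab.2 (by rintro _ (rfl | rfl) <;> assumption)⟩, hab.1 (by simp),
      hab.1 (by simp)⟩
    intro s w hne hdir hw hcw
    obtain ⟨y, hy, hay⟩ := ha s w hne hdir hw ((hab.1 (by simp)).trans hcw)
    obtain ⟨z, hz, hbz⟩ := hb s w hne hdir hw ((hab.1 (by simp)).trans hcw)
    obtain ⟨t, ht, hyt, hzt⟩ := hdir y hy z hz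
    exact ⟨t, ht, hab.2 (by rintro _ (rfl | rfl); exacts [hay.trans hyt, hbz.trans hzt])⟩
  algebraic_isLUB x := ⟨fun _ h => h.2, fun _ hw => (hlub x).2 fun k hk => hw ⟨hc k hk.1, hk.2⟩⟩
  countable_compact := by
    -- Every compact element will be the supremum of a finite subset of `S`. There are countably
    -- many such subsets, and each has at most one supremum.
    have hT : (⋃ t ∈ {t : Set D | t.Finite ∧ t ⊆ S}, {x | IsLUB t x}).Countable :=
      (Set.countable_ofPred_finite_subset hS).biUnion fun t _ =>
        Set.Subsingleton.countable fun _ hx _ hy => hx.unique hy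
    refine hT.mono fun k hk => ?_
    have bdd : ∀ t : Set D, t ⊆ {s | s ∈ S ∧ s ≤ k} → BddAbove t :=
      fun t ht => ⟨k, fun _ hx => (ht hx).2⟩
    -- Compactness of `k` is applied to the suprema of finite sets of basis elements below `k`. They
    -- form a directed set, nonempty because of the empty supremum `⊥`, and their supremum is `k`.
    obtain ⟨x, ⟨t, ht, htS, hx⟩, hkx⟩ :=
      hk {x | ∃ t : Set D, t.Finite ∧ t ⊆ {s | s ∈ S ∧ s ≤ k} ∧ IsLUB t x} k
        ⟨⊥, ∅, Set.finite_empty, Set.empty_subset _, by simp⟩ (by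
          rintro x ⟨t, ht, htS, hx⟩ y ⟨t', ht', htS', hy⟩
          obtain ⟨z, hz⟩ := bc (t ∪ t') (bdd _ (Set.union_subset htS htS'))
          exact ⟨z, ⟨_, ht.union ht', Set.union_subset htS htS', hz⟩,
            hx.2 fun _ h => hz.1 (Or.inl h), hy.2 fun _ h => hz.1 (Or.inr h)⟩)
        ⟨by
          rintro x ⟨t, -, htS, hx⟩
          exact hx.2 fun _ h => (htS h).2, fun w hw => (hlub k).2 fun s hs =>
            hw ⟨{s}, Set.finite_singleton s, by simpa using hs, isLUB_singleton⟩⟩ le_rfl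
    have : k = x := le_antisymm hkx (hx.2 fun _ h => (htS h).2)
    subst this
    exact Set.mem_biUnion (x := t) ⟨ht, fun _ h => (htS h).1⟩ hx

/-! ### Strict maps -/

namespace StrictMap

lemma continuous (f : StrictMap A B) : ScottContinuous f := f.continuous'

lemma monotone (f : StrictMap A B) : Monotone f := f.continuous.monotone

@[simp] lemma map_bot (f : StrictMap A B) : f ⊥ = ⊥ := f.strict'

lemma ext_apply {f g : StrictMap A B} (h : ∀ x, f x = g x) : f = g := DFunLike.ext _ _ h

lemma le_def {f g : StrictMap A B} : f ≤ g ↔ ∀ x, f x ≤ g x := Iff.rfl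

instance : OrderBot (StrictMap A B) where
  bot := ⟨fun _ => ⊥, ScottContinuous.const ⊥, rfl⟩
  bot_le _ _ := bot_le

lemma isLUB_of_apply {F : Set (StrictMap A B)} {f : StrictMap A B}
    (h : ∀ x, IsLUB ((fun g : StrictMap A B => g x) '' F) (f x)) : IsLUB F f :=
  ⟨fun g hg x => (h x).1 ⟨g, hg, rfl⟩, fun w hw x => (h x).2 <| by
    rintro _ ⟨g, hg, rfl⟩
    exact hw hg x⟩

/-- If all pointwise least upper bounds exist, then they form a strict continuous function. -/
lemma exists_isLUB_apply {F : Set (StrictMap A B)}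
    (h : ∀ x, ∃ b, IsLUB ((fun g : StrictMap A B => g x) '' F) b) :
    ∃ f : StrictMap A B, ∀ x, IsLUB ((fun g : StrictMap A B => g x) '' F) (f x) := by
  choose f hf using h
  refine ⟨⟨f, ?_, ?_⟩, hf⟩
  · refine scottContinuous_of_isLUB (F := (fun g : StrictMap A B => (g : A → B)) '' F) ?_ ?_
    · rintro _ ⟨g, -, rfl⟩
      exact g.continuous
    · intro x
      rw [Set.image_image]
      exact hf x
  · refine le_bot_iff.1 ((hf ⊥).2 ?_)
    rintro _ ⟨g, -, rfl⟩
    simp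

lemma directedOn_apply {F : Set (StrictMap A B)} (hF : DirectedOn (· ≤ ·) F) (x : A) :
    DirectedOn (· ≤ ·) ((fun g : StrictMap A B => g x) '' F) := by
  rintro _ ⟨f, hf, rfl⟩ _ ⟨g, hg, rfl⟩
  obtain ⟨k, hk, hfk, hgk⟩ := hF f hf g hg
  exact ⟨k x, ⟨k, hk, rfl⟩, hfk x, hgk x⟩

lemma exists_isLUB_apply_of_directedOn (hB : IsScottDomain B) {F : Set (StrictMap A B)}
    (hF : DirectedOn (· ≤ ·) F) (hne : F.Nonempty) :
    ∃ f : StrictMap A B, ∀ x, IsLUB ((fun g : StrictMap A B => g x) '' F) (f x) :=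
  exists_isLUB_apply fun x => hB.directedComplete _ (hne.image _) (directedOn_apply hF x)

/-- The pointwise suprema of a directed family exist and form a strict continuous function, which is
the supremum by uniqueness. So directed suprema in the function space can only be the pointwise
ones. -/
lemma isLUB_apply (hB : IsScottDomain B) {F : Set (StrictMap A B)} (hF : DirectedOn (· ≤ ·) F)
    (hne : F.Nonempty) {f : StrictMap A B} (h : IsLUB F f) (x : A) :
    IsLUB ((fun g : StrictMap A B => g x) '' F) (f x) := by
  obtain ⟨k, hk⟩ := exists_isLUB_apply_of_directedOn hB hF hne
  rw [h.unique (isLUB_of_apply hk)]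
  exact hk x

open Classical in
/-- The step function with value `b` above the compact element `a` and `⊥` elsewhere. -/
noncomputable def step {a : A} (ha : IsCompactElement a) (ha' : a ≠ ⊥) (b : B) :
    StrictMap A B where
  toFun x := if a ≤ x then b else ⊥
  continuous' := by
    intro d hd hdir x hx
    refine ⟨?_, fun w hw => ?_⟩
    · rintro _ ⟨y, hy, rfl⟩
      have := hx.1 hy
      beta_reduce
      split_ifs with h h'
      exacts [le_rfl, absurd (h.trans this) h', bot_le, le_rfl]
    · beta_reduce
      split_ifs with h
      · obtain ⟨y, hy, hay⟩ := ha d x hd hdir hx h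
        exact hw ⟨y, hy, if_pos hay⟩
      · exact bot_le
  strict' := if_neg fun h => ha' (le_bot_iff.1 h)

/-- Approximation by step functions is governed by values at the single point `a`. Compactness of a
step function thus reduces to compactness of `b`, directed suprema being pointwise. -/
lemma step_le_iff {a : A} (ha : IsCompactElement a) (ha' : a ≠ ⊥) (b : B) (f : StrictMap A B) :
    step ha ha' b ≤ f ↔ b ≤ f a := by
  refine ⟨fun h => ?_, fun h => le_def.2 fun x => ?_⟩
  · have := le_def.1 h a
    rwa [show step ha ha' b a = b from if_pos le_rfl] at this
  · by_cases hx : a ≤ x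
    · rw [show step ha ha' b x = b from if_pos hx]
      exact h.trans (f.monotone hx)
    · rw [show step ha ha' b x = ⊥ from if_neg hx]
      exact bot_le

/-- The strict continuous functions between Scott domains form a Scott domain. -/
lemma isScottDomain (hA : IsScottDomain A) (hB : IsScottDomain B) :
    IsScottDomain (StrictMap A B) := by
  have := hA.countable_compact.to_subtype
  have := hB.countable_compact.to_subtype
  refine IsScottDomain.of_basis (fun F hne hF => ?_) (fun F hF => ?_)
    (Set.range fun p : {p : {k : A | IsCompactElement k} × {k : B | IsCompactElement k} //
      (p.1 : A) ≠ ⊥} => step p.1.1.2 p.2 (p.1.2 : B)) (Set.countable_range _) ?_ fun f => ?_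
  · obtain ⟨f, hf⟩ := exists_isLUB_apply_of_directedOn hB hF hne
    exact ⟨f, isLUB_of_apply hf⟩
  · obtain ⟨w, hw⟩ := hF
    obtain ⟨f, hf⟩ := exists_isLUB_apply (F := F) fun x => hB.boundedComplete _ ⟨w x, by
      rintro _ ⟨g, hg, rfl⟩
      exact hw hg x⟩
    exact ⟨f, isLUB_of_apply hf⟩
  · rintro _ ⟨⟨⟨⟨a, ha⟩, ⟨b, hb⟩⟩, ha'⟩, rfl⟩ F f hne hF hf hle
    obtain ⟨_, ⟨g, hg, rfl⟩, hbg⟩ := hb _ _ (hne.image _) (directedOn_apply hF a)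
      (isLUB_apply hB hF hne hf a) ((step_le_iff ha ha' b f).1 hle)
    exact ⟨g, hg, (step_le_iff ha ha' b g).2 hbg⟩
  · refine ⟨fun _ h => h.2, fun w hw x => ?_⟩
    refine (f.continuous (d := {k | IsCompactElement k ∧ k ≤ x})
      ⟨⊥, isCompactElement_bot, bot_le⟩ (hA.algebraic_directed x)
      (hA.algebraic_isLUB x)).2 ?_
    rintro _ ⟨a, ⟨ha, hax⟩, rfl⟩
    -- There is no strict step function at `⊥`, but none is needed since `f ⊥ = ⊥`.
    by_cases ha' : a = ⊥
    · simp [ha']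
    refine ((hB.algebraic_isLUB (f a)).2 ?_).trans (w.monotone hax)
    rintro b ⟨hb, hbf⟩
    exact (step_le_iff ha ha' b w).1 (hw ⟨⟨⟨⟨⟨a, ha⟩, ⟨b, hb⟩⟩, ha'⟩, rfl⟩,
      (step_le_iff ha ha' b f).2 hbf⟩)

lemma continuous_of_apply {X : Type*} [Preorder X] {f : X → StrictMap A B}
    (hf : ∀ a, ScottContinuous fun x => f x a) : ScottContinuous f := by
  intro d hd hdir x hx
  refine isLUB_of_apply fun a => ?_
  rw [Set.image_image]
  exact hf a hd hdir hx

/-- Separate continuity gives joint continuity. In the function variable it holds because directed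
suprema are pointwise. -/
lemma continuous_eval (hB : IsScottDomain B) :
    ScottContinuous fun p : StrictMap A B × A => p.1 p.2 :=
  ScottContinuous.fromProd (fun f => f.continuous)
    fun a _ hd hdir _ hf => isLUB_apply hB hdir hd hf a

lemma continuous_apply (hB : IsScottDomain B) {X : Type*} [Preorder X] {f : X → StrictMap A B}
    {g : X → A} (hf : ScottContinuous f) (hg : ScottContinuous g) :
    ScottContinuous fun x => f x (g x) :=
  (hf.prodMk hg).comp (continuous_eval hB)

end StrictMap

/-! ### Products -/

lemma IsScottDomain.prod (hA : IsScottDomain A) (hB : IsScottDomain B) :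
    IsScottDomain (A × B) := by
  refine .of_basis (fun s hne hs => ?_) (fun s hs => ?_)
    ({k | IsCompactElement k} ×ˢ {k | IsCompactElement k})
    (hA.countable_compact.prod hB.countable_compact) ?_ fun x => ?_
  · obtain ⟨a, ha⟩ := hA.directedComplete _ (hne.image _) hs.fst
    obtain ⟨b, hb⟩ := hB.directedComplete _ (hne.image _) hs.snd
    exact ⟨(a, b), isLUB_prod.2 ⟨ha, hb⟩⟩
  · obtain ⟨a, ha⟩ := hA.boundedComplete _ (monotone_fst.map_bddAbove hs)
    obtain ⟨b, hb⟩ := hB.boundedComplete _ (monotone_snd.map_bddAbove hs)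
    exact ⟨(a, b), isLUB_prod.2 ⟨ha, hb⟩⟩
  · rintro ⟨a, b⟩ ⟨ha, hb⟩ s w hne hs hw hle
    obtain ⟨_, ⟨p, hp, rfl⟩, hap⟩ := ha _ _ (hne.image _) hs.fst (isLUB_prod.1 hw).1 hle.1
    obtain ⟨_, ⟨q, hq, rfl⟩, hbq⟩ := hb _ _ (hne.image _) hs.snd (isLUB_prod.1 hw).2 hle.2
    obtain ⟨r, hr, hpr, hqr⟩ := hs p hp q hq
    exact ⟨r, hr, hap.trans hpr.1, hbq.trans hqr.2⟩
  · refine ⟨fun _ h => h.2, fun w hw => ⟨(hA.algebraic_isLUB x.1).2 ?_,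
      (hB.algebraic_isLUB x.2).2 ?_⟩⟩
    · rintro k ⟨hk, hkx⟩
      -- Compact elements of one factor are tested by padding with `⊥`, which is compact.
      exact (@hw (k, ⊥) ⟨⟨hk, isCompactElement_bot⟩, hkx, bot_le⟩).1
    · rintro k ⟨hk, hkx⟩
      exact (@hw (⊥, k) ⟨⟨isCompactElement_bot, hk⟩, bot_le, hkx⟩).2

/-! ### Lifting -/

lemma IsScottDomain.withBot (hA : IsScottDomain A) : IsScottDomain (WithBot A) := by
  refine .of_basis (fun s _ hs => ?_) (fun s hs => ?_)
    (WithBot.some '' {k : A | IsCompactElement k}) (hA.countable_compact.image _) ?_ fun x => ?_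
  · by_cases h : (WithBot.some ⁻¹' s : Set A).Nonempty
    · obtain ⟨a, ha⟩ := hA.directedComplete _ h (directedOn_preimage_coe hs)
      exact ⟨a, isLUB_coe_of_preimage h ha⟩
    · exact ⟨⊥, isLUB_bot_of_preimage h⟩
  · by_cases h : (WithBot.some ⁻¹' s : Set A).Nonempty
    · obtain ⟨w, hw⟩ := hs
      obtain ⟨a, ha⟩ := hA.boundedComplete (WithBot.some ⁻¹' s) <| by
        obtain ⟨b, hb⟩ := h
        have hbw := hw hb
        induction w with
        | bot => exact absurd hbw (by simp)
        | coe w => exact ⟨w, fun x hx => WithBot.coe_le_coe.1 (hw hx)⟩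
      exact ⟨a, isLUB_coe_of_preimage h ha⟩
    · exact ⟨⊥, isLUB_bot_of_preimage h⟩
  · rintro _ ⟨a, ha, rfl⟩ s w hne hs hw hle
    induction w with
    | bot => exact absurd hle (by simp)
    | coe w =>
      obtain ⟨h, hw⟩ := isLUB_preimage_of_coe hw
      obtain ⟨x, hx, hax⟩ := ha _ _ h (directedOn_preimage_coe hs) hw (WithBot.coe_le_coe.1 hle)
      exact ⟨x, hx, WithBot.coe_le_coe.2 hax⟩
  · refine ⟨fun _ h => h.2, fun w hw => ?_⟩
    induction x with
    | bot => exact bot_le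
    | coe x =>
      -- The lifting of `⊥` belongs to the basis, so an upper bound cannot be the new bottom
      -- element.
      have h := hw ⟨⟨⊥, isCompactElement_bot, rfl⟩, WithBot.coe_le_coe.2 bot_le⟩
      induction w with
      | bot => exact absurd h (by simp)
      | coe w =>
        refine WithBot.coe_le_coe.2 ((hA.algebraic_isLUB x).2 ?_)
        rintro k ⟨hk, hkx⟩
        exact WithBot.coe_le_coe.1 (hw ⟨⟨k, hk, rfl⟩, WithBot.coe_le_coe.2 hkx⟩)

/-- The strict extension of a Scott continuous function to the lifting. -/
def liftMap (f : A → B) (hf : ScottContinuous f) : StrictMap (WithBot A) B where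
  toFun := WithBot.recBotCoe ⊥ f
  continuous' := by
    intro d hd hdir x hx
    induction x with
    | bot =>
      refine ⟨?_, fun _ _ => bot_le⟩
      rintro _ ⟨y, hy, rfl⟩
      rw [le_bot_iff.1 (hx.1 hy)]
    | coe a =>
      obtain ⟨hne, ha⟩ := isLUB_preimage_of_coe hx
      have h := hf hne (directedOn_preimage_coe hdir) ha
      refine ⟨?_, fun w hw => h.2 ?_⟩
      · rintro _ ⟨y, hy, rfl⟩
        induction y with
        | bot => exact bot_le
        | coe y => exact h.1 ⟨y, hy, rfl⟩
      · rintro _ ⟨y, hy, rfl⟩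
        exact hw ⟨y, hy, rfl⟩
  strict' := rfl

/-! ### Smash products -/

@[simp] lemma smashPair_bot_left (b : B) : smashPair (⊥ : A) b = ⊥ := by simp [smashPair]

@[simp] lemma smashPair_bot_right (a : A) : smashPair a (⊥ : B) = ⊥ := by simp [smashPair]

lemma smashPair_of_ne_bot {a : A} {b : B} (ha : a ≠ ⊥) (hb : b ≠ ⊥) :
    smashPair a b = WithBot.some (⟨a, ha⟩, ⟨b, hb⟩) := by simp [smashPair, ha, hb]

/-- The pair of components of an element of the smash product. -/
def smashSplit : Smash A B → A × B := WithBot.recBotCoe ⊥ fun p => (p.1, p.2)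

@[simp] lemma smashSplit_bot : smashSplit (⊥ : Smash A B) = ⊥ := rfl

lemma smashSplit_coe (a : {a : A // a ≠ ⊥}) (b : {b : B // b ≠ ⊥}) :
    smashSplit ((a, b) : Smash A B) = (a.1, b.1) := rfl

lemma smashSplit_pair {a : A} {b : B} (ha : a ≠ ⊥) (hb : b ≠ ⊥) :
    smashSplit (smashPair a b) = (a, b) := by
  rw [smashPair_of_ne_bot ha hb, smashSplit_coe]

@[simp] lemma smashPair_split (x : Smash A B) :
    smashPair (smashSplit x).1 (smashSplit x).2 = x := by
  induction x using WithBot.recBotCoe with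
  | bot => simp
  | coe x => exact smashPair_of_ne_bot x.1.2 x.2.2

/-- If `x` has non-bottom components `c` and `e`, then `(c, e) ≤ (a, b)` forces `a` and `b` to be
non-bottom, and both sides are componentwise comparison. As a left adjoint, splitting preserves all
suprema. Together with `smashPair_split` this makes the smash product a retract of `A × B`. -/
lemma smashSplit_gc : GaloisConnection (smashSplit : Smash A B → A × B)
    fun p => smashPair p.1 p.2 := by
  rintro x ⟨a, b⟩
  induction x using WithBot.recBotCoe with
  | bot => simp
  | coe x =>
    obtain ⟨⟨c, hc⟩, ⟨e, he⟩⟩ := x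
    rw [smashSplit_coe]
    by_cases ha : a = ⊥
    · simp [ha, hc]
    by_cases hb : b = ⊥
    · simp [hb, he]
    simp only [smashPair_of_ne_bot ha hb, WithBot.coe_le_coe]
    rfl

lemma monotone_smashSplit : Monotone (smashSplit : Smash A B → A × B) := smashSplit_gc.monotone_l

lemma scottContinuous_smashSplit : ScottContinuous (smashSplit : Smash A B → A × B) :=
  fun _ _ _ _ h => smashSplit_gc.isLUB_l_image h

lemma monotone_smashPair : Monotone fun p : A × B => smashPair p.1 p.2 := smashSplit_gc.monotone_u

/-- Pairing is a right adjoint, so continuity is not automatic. It holds because a directed set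
whose supremum has non-bottom components eventually has non-bottom components itself. -/
lemma scottContinuous_smashPair : ScottContinuous fun p : A × B => smashPair p.1 p.2 := by
  rintro d hd hdir ⟨a, b⟩ h
  refine ⟨?_, fun w hw => ?_⟩
  · rintro _ ⟨y, hy, rfl⟩
    exact monotone_smashPair (h.1 hy)
  · by_cases ha : a = ⊥
    · simp [ha]
    by_cases hb : b = ⊥
    · simp [hb]
    rw [isLUB_prod] at h
    obtain ⟨_, ⟨p, hp, rfl⟩, hpb⟩ := isLUB_exists_ne_bot h.1 ha
    obtain ⟨_, ⟨q, hq, rfl⟩, hqb⟩ := isLUB_exists_ne_bot h.2 hb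
    -- Both components of `r` are non-bottom. At elements above `r` splitting undoes pairing, so a
    -- bound on the pairs is a bound on the components.
    obtain ⟨r, hr, hpr, hqr⟩ := hdir p hp q hq
    rw [← isLUB_prod] at h
    refine (smashSplit_gc _ _).1 ?_ |>.trans (smashPair_split w).le
    rw [smashSplit_pair ha hb]
    refine h.2 fun y hy => ?_
    obtain ⟨z, hz, hyz, hrz⟩ := hdir y hy r hr
    have := monotone_smashSplit (hw ⟨z, hz, rfl⟩)
    rw [smashSplit_pair (ne_bot_of_le_ne_bot hpb (hpr.1.trans hrz.1))
      (ne_bot_of_le_ne_bot hqb (hqr.2.trans hrz.2))] at this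
    exact hyz.trans this

lemma isLUB_smashPair_of_split {s : Set (Smash A B)} {p : A × B} (h : IsLUB (smashSplit '' s) p) :
    IsLUB s (smashPair p.1 p.2) := by
  refine ⟨fun x hx => (smashSplit_gc _ _).1 (h.1 ⟨x, hx, rfl⟩), fun w hw => ?_⟩
  rw [← smashPair_split w]
  refine monotone_smashPair (h.2 ?_)
  rintro _ ⟨x, hx, rfl⟩
  exact monotone_smashSplit (hw hx)

/-- Suprema are computed in `A × B` and paired. The basis is restricted to compact pairs with
non-bottom components, because there splitting recovers the pair and compactness carries over from
the product. The omitted pairs all become `⊥`. -/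
lemma IsScottDomain.smash (hA : IsScottDomain A) (hB : IsScottDomain B) :
    IsScottDomain (Smash A B) := by
  have h := hA.prod hB
  refine .of_basis (fun s hne hs => ?_) (fun s hs => ?_)
    ((fun p : A × B => smashPair p.1 p.2) ''
      {p | IsCompactElement p ∧ p.1 ≠ ⊥ ∧ p.2 ≠ ⊥})
    ((h.countable_compact.mono fun _ h => h.1).image _) ?_ fun x => ?_
  · obtain ⟨p, hp⟩ := h.directedComplete _ (hne.image smashSplit)
      (hs.mono_comp fun _ _ h => monotone_smashSplit h)
    exact ⟨_, isLUB_smashPair_of_split hp⟩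
  · obtain ⟨p, hp⟩ := h.boundedComplete _ (monotone_smashSplit.map_bddAbove hs)
    exact ⟨_, isLUB_smashPair_of_split hp⟩
  · rintro _ ⟨⟨a, b⟩, ⟨hk, ha, hb⟩, rfl⟩ s w hne hs hw hle
    have hle' := monotone_smashSplit hle
    rw [smashSplit_pair ha hb] at hle'
    obtain ⟨_, ⟨y, hy, rfl⟩, hky⟩ := hk _ _ (hne.image smashSplit)
      (hs.mono_comp fun _ _ h => monotone_smashSplit h) (scottContinuous_smashSplit hne hs hw) hle'
    exact ⟨y, hy, (monotone_smashPair hky).trans (smashPair_split y).le⟩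
  · refine ⟨fun _ h => h.2, fun w hw => ?_⟩
    rw [← smashPair_split x] at hw ⊢
    generalize smashSplit x = p at hw ⊢
    obtain ⟨a, b⟩ := p
    by_cases ha : a = ⊥
    · simp [ha]
    by_cases hb : b = ⊥
    · simp [hb]
    refine (scottContinuous_smashPair (d := {k | IsCompactElement k ∧ k ≤ (a, b)})
      ⟨⊥, isCompactElement_bot, bot_le⟩
      (h.algebraic_directed (a, b)) (h.algebraic_isLUB (a, b))).2 ?_
    rintro _ ⟨⟨c, e⟩, ⟨hk, hle⟩, rfl⟩
    by_cases hc : c = ⊥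
    · simp [hc]
    by_cases he : e = ⊥
    · simp [he]
    exact hw ⟨⟨(c, e), ⟨hk, hc, he⟩, rfl⟩, monotone_smashPair hle⟩

/-- The first component of an element of the smash product. -/
def smashFst (A B : Type u) [PartialOrder A] [OrderBot A] [PartialOrder B] [OrderBot B] :
    StrictMap (Smash A B) A where
  toFun x := (smashSplit x).1
  continuous' := scottContinuous_smashSplit.comp .fst
  strict' := rfl

/-- The second component of an element of the smash product. -/
def smashSnd (A B : Type u) [PartialOrder A] [OrderBot A] [PartialOrder B] [OrderBot B] :
    StrictMap (Smash A B) B where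
  toFun x := (smashSplit x).2
  continuous' := scottContinuous_smashSplit.comp .snd
  strict' := rfl

/-- The map out of the smash product induced by a bistrict continuous function. -/
def smashLift (f : A → B → D) (hf : ScottContinuous fun p : A × B => f p.1 p.2)
    (h₁ : ∀ b, f ⊥ b = ⊥) (_ : ∀ a, f a ⊥ = ⊥) : StrictMap (Smash A B) D where
  toFun x := f (smashSplit x).1 (smashSplit x).2
  continuous' := scottContinuous_smashSplit.comp hf
  strict' := h₁ ⊥

lemma smashLift_pair (f : A → B → D) (hf : ScottContinuous fun p : A × B => f p.1 p.2)
    (h₁ : ∀ b, f ⊥ b = ⊥) (h₂ : ∀ a, f a ⊥ = ⊥) (a : A) (b : B) :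
    smashLift f hf h₁ h₂ (smashPair a b) = f a b := by
  by_cases ha : a = ⊥
  · subst ha
    simp [h₁]
  by_cases hb : b = ⊥
  · subst hb
    simp [h₂]
  change f _ _ = _
  rw [smashSplit_pair ha hb]

lemma smash_continuous {X : Type*} [Preorder X] {f : X → A} {g : X → B} (hf : ScottContinuous f)
    (hg : ScottContinuous g) : ScottContinuous fun x => smashPair (f x) (g x) :=
  (hf.prodMk hg).comp scottContinuous_smashPair

/-- The map sending all elements other than `⊥` to the top element of the Sierpinski domain. -/
noncomputable def discard (A : Type u) [PartialOrder A] [OrderBot A] :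
    StrictMap A (WithBot PUnit.{u + 1}) where
  toFun := by
    classical exact fun x => if x = ⊥ then ⊥ else WithBot.some PUnit.unit
  continuous' := by
    intro d hd hdir x hx
    refine ⟨?_, fun w hw => ?_⟩
    · rintro _ ⟨y, hy, rfl⟩
      by_cases h : y = ⊥
      · simp [h]
      · simp [h, ne_bot_of_le_ne_bot h (hx.1 hy)]
    · by_cases h : x = ⊥
      · simp [h]
      · obtain ⟨y, hy, hy'⟩ := isLUB_exists_ne_bot hx h
        have := hw ⟨y, hy, rfl⟩
        simpa [h, hy'] using this
  strict' := by simp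

lemma discard_of_ne_bot {a : A} (ha : a ≠ ⊥) : discard A a = WithBot.some PUnit.unit :=
  if_neg ha

/-! ### Flat domains -/

instance : OrderBot FlatNat where
  bot := .bot
  bot_le _ := Or.inl rfl

lemma FlatNat.le_iff {x y : ULift.{u} FlatNat} : x ≤ y ↔ x = ⊥ ∨ x = y := by
  constructor
  · rintro (h | h)
    · exact Or.inl (ULift.ext _ _ h)
    · exact Or.inr (ULift.ext _ _ h)
  · rintro (h | h)
    · exact Or.inl (congrArg ULift.down h)
    · exact Or.inr (congrArg ULift.down h)

/-- A directed set in a flat order has at most one element besides `⊥`. Directed suprema are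
therefore attained, so every element is compact and every monotone function is continuous. -/
lemma FlatNat.exists_isGreatest {s : Set (ULift.{u} FlatNat)} (hne : s.Nonempty)
    (hs : DirectedOn (· ≤ ·) s) : ∃ x, IsGreatest s x := by
  by_cases h : ∃ x ∈ s, x ≠ ⊥
  · obtain ⟨x, hx, hx'⟩ := h
    refine ⟨x, hx, fun y hy => ?_⟩
    obtain ⟨z, hz, hxz, hyz⟩ := hs x hx y hy
    obtain rfl := (FlatNat.le_iff.1 hxz).resolve_left hx'
    exact hyz
  · push Not at h
    obtain ⟨x, hx⟩ := hne
    exact ⟨x, hx, fun y hy => (h y hy).le.trans bot_le⟩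

/-- Strict functions on the flat natural numbers are continuous. -/
def flatMap (f : ULift.{u} FlatNat → B) (hf : f ⊥ = ⊥) : StrictMap (ULift.{u} FlatNat) B where
  toFun := f
  continuous' := by
    have mono : Monotone f := fun x y h => by
      rcases FlatNat.le_iff.1 h with rfl | rfl
      · simp [hf]
      · exact le_rfl
    intro d hd hdir x hx
    obtain ⟨y, hy⟩ := FlatNat.exists_isGreatest hd hdir
    rw [hx.unique hy.isLUB]
    exact (mono.map_isGreatest hy).isLUB
  strict' := hf

lemma FlatNat.isScottDomain : IsScottDomain (ULift.{u} FlatNat) := by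
  have : Function.Surjective fun n : Option ℕ =>
      (ULift.up (n.elim .bot .nat) : ULift.{u} FlatNat) := by
    rintro ⟨_ | n⟩
    exacts [⟨none, rfl⟩, ⟨some n, rfl⟩]
  have := this.countable
  refine .of_basis (fun s hne hs => ?_) (fun s hs => ?_) Set.univ (Set.to_countable _) ?_ fun x => ?_
  · obtain ⟨x, hx⟩ := FlatNat.exists_isGreatest hne hs
    exact ⟨x, hx.isLUB⟩
  · obtain ⟨w, hw⟩ := hs
    by_cases h : w ∈ s
    · exact ⟨w, IsGreatest.isLUB ⟨h, hw⟩⟩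
    · refine ⟨⊥, fun x hx => ?_, fun _ _ => bot_le⟩
      rcases FlatNat.le_iff.1 (hw hx) with rfl | rfl
      exacts [le_rfl, absurd hx h]
  · intro k _ s w hne hs hw hk
    obtain ⟨x, hx⟩ := FlatNat.exists_isGreatest hne hs
    rw [hw.unique hx.isLUB] at hk
    exact ⟨x, hx.1, hk⟩
  · exact IsGreatest.isLUB ⟨⟨trivial, le_rfl⟩, fun _ h => h.2⟩

lemma isScottDomain_punit : IsScottDomain PUnit.{u + 1} :=
  .of_basis (fun _ _ _ => ⟨⊥, fun _ _ => le_rfl, fun _ _ => le_rfl⟩)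
    (fun _ _ => ⟨⊥, fun _ _ => le_rfl, fun _ _ => le_rfl⟩) ∅ Set.countable_empty
    (fun _ h => h.elim) fun _ => ⟨fun _ _ => le_rfl, fun _ _ => le_rfl⟩

/-! ### Least fixed points -/

/-- The finite iterations of `b ↦ f (up b)`, starting from `⊥`. -/
def iter (f : StrictMap (WithBot B) B) : ℕ → B
  | 0 => ⊥
  | n + 1 => f (iter f n : WithBot B)

lemma iter_le_succ (f : StrictMap (WithBot B) B) (n : ℕ) : iter f n ≤ iter f (n + 1) := by
  induction n with
  | zero => exact bot_le
  | succ n ih => exact f.monotone (WithBot.coe_le_coe.2 ih)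

lemma directedOn_iter (f : StrictMap (WithBot B) B) : DirectedOn (· ≤ ·) (Set.range (iter f)) :=
  (monotone_nat_of_le_succ (iter_le_succ f)).directed_le.directedOn_range

lemma continuous_iter (hB : IsScottDomain B) (n : ℕ) :
    ScottContinuous fun f : StrictMap (WithBot B) B => iter f n := by
  induction n with
  | zero => exact ScottContinuous.const ⊥
  | succ n ih =>
    exact StrictMap.continuous_apply hB ScottContinuous.id (ih.comp scottContinuous_coe)

lemma exists_isLUB_iter (hB : IsScottDomain B) (f : StrictMap (WithBot B) B) :
    ∃ b, IsLUB (Set.range (iter f)) b :=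
  hB.directedComplete _ (Set.range_nonempty _) (directedOn_iter f)

/-- The least fixed point of `b ↦ f (up b)`. -/
noncomputable def lfp (hB : IsScottDomain B) (f : StrictMap (WithBot B) B) : B :=
  (exists_isLUB_iter hB f).choose

lemma isLUB_lfp (hB : IsScottDomain B) (f : StrictMap (WithBot B) B) :
    IsLUB (Set.range (iter f)) (lfp hB f) := (exists_isLUB_iter hB f).choose_spec

/-- Kleene's argument: `b ↦ f (up b)` is continuous, hence sends the supremum of the iterates to
that of the shifted iterates, which is the same. -/
lemma lfp_eq (hB : IsScottDomain B) (f : StrictMap (WithBot B) B) :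
    f (WithBot.some (lfp hB f)) = lfp hB f := by
  have h := (scottContinuous_coe.comp f.continuous) (Set.range_nonempty _) (directedOn_iter f)
    (isLUB_lfp hB f)
  refine le_antisymm (h.2 ?_) ((isLUB_lfp hB f).2 ?_)
  · rintro _ ⟨_, ⟨n, rfl⟩, rfl⟩
    exact (isLUB_lfp hB f).1 ⟨n + 1, rfl⟩
  · rintro _ ⟨n, rfl⟩
    exact (iter_le_succ f n).trans (h.1 ⟨_, ⟨n, rfl⟩, rfl⟩)

lemma isLeast_lfp (hB : IsScottDomain B) (f : StrictMap (WithBot B) B) :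
    IsLeast {b : B | f (WithBot.some b) = b} (lfp hB f) := by
  refine ⟨lfp_eq hB f, fun b hb => (isLUB_lfp hB f).2 ?_⟩
  rintro _ ⟨n, rfl⟩
  induction n with
  | zero => exact bot_le
  | succ n ih => exact (f.monotone (WithBot.coe_le_coe.2 ih)).trans_eq hb

/-- This is what makes the fixpoint operator a morphism: it is a pointwise supremum of the
continuous functions `f ↦ iter f n`. -/
lemma continuous_lfp (hB : IsScottDomain B) :
    ScottContinuous fun f : StrictMap (WithBot B) B => lfp hB f := by
  refine scottContinuous_of_isLUB
    (F := Set.range fun (n : ℕ) (f : StrictMap (WithBot B) B) => iter f n) ?_ fun f => ?_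
  · rintro _ ⟨n, rfl⟩
    exact continuous_iter hB n
  · rw [← Set.range_comp]
    exact isLUB_lfp hB f

end OrderTheory

/-! ## The symmetric monoidal closed structure -/

namespace StrictBcdom

lemma hom_ext {A B : StrictBcdom.{u}} {f g : A ⟶ B} (h : ∀ x : A, f x = g x) : f = g :=
  StrictMap.ext_apply h

@[simp] lemma hom_bot {A B : StrictBcdom.{u}} (f : A ⟶ B) : f (⊥ : A) = ⊥ :=
  StrictMap.map_bot (A := A) (B := B) f

lemma hom_continuous {A B : StrictBcdom.{u}} (f : A ⟶ B) : ScottContinuous fun x : A => f x :=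
  StrictMap.continuous (A := A) (B := B) f

/-- The smash product of Scott domains. -/
abbrev smash (A B : StrictBcdom.{u}) : StrictBcdom.{u} :=
  ⟨Smash A B, A.isScottDomain.smash B.isScottDomain⟩

/-- The Sierpinski domain. -/
abbrev sierpinski : StrictBcdom.{u} := ⟨WithBot PUnit.{u + 1}, isScottDomain_punit.withBot⟩

section Maps

variable {A B D A' B' : StrictBcdom.{u}}

/-- The morphism out of the smash product induced by a bistrict continuous function. -/
def smashDesc (f : A → B → D) (hf : ScottContinuous fun p : A × B => f p.1 p.2)
    (h₁ : ∀ b, f ⊥ b = ⊥) (h₂ : ∀ a, f a ⊥ = ⊥) : smash A B ⟶ D :=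
  smashLift f hf h₁ h₂

lemma smashDesc_pair (f : A → B → D) (hf : ScottContinuous fun p : A × B => f p.1 p.2)
    (h₁ : ∀ b, f ⊥ b = ⊥) (h₂ : ∀ a, f a ⊥ = ⊥) (a : A) (b : B) :
    smashDesc f hf h₁ h₂ (smashPair a b) = f a b :=
  smashLift_pair f hf h₁ h₂ a b

/-- The smash product of strict continuous functions. -/
noncomputable def smashMap (f : A ⟶ A') (g : B ⟶ B') : smash A B ⟶ smash A' B' :=
  smashDesc (fun (a : A) (b : B) => smashPair (f a) (g b))
    (smash_continuous (ScottContinuous.fst.comp (hom_continuous f))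
      (ScottContinuous.snd.comp (hom_continuous g))) (by simp) (by simp)

lemma smashMap_pair (f : A ⟶ A') (g : B ⟶ B') (a : A) (b : B) :
    smashMap f g (smashPair a b) = smashPair (f a) (g b) :=
  smashDesc_pair _ _ _ _ _ _

lemma smash_surjective (x : smash A B) : ∃ (a : A) (b : B), x = smashPair a b :=
  ⟨_, _, (smashPair_split x).symm⟩

variable (A B D) in
/-- Reassociation from left to right. -/
noncomputable def assocHom : smash (smash A B) D ⟶ smash A (smash B D) :=
  smashDesc (fun (x : Smash A B) (c : D) =>
    smashPair (smashFst A B x) (smashPair (smashSnd A B x) c))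
    (smash_continuous (ScottContinuous.fst.comp (smashFst A B).continuous)
      (smash_continuous (ScottContinuous.fst.comp (smashSnd A B).continuous) ScottContinuous.snd))
    (by simp) (by simp)

lemma assocHom_pair (a : A) (b : B) (c : D) :
    assocHom A B D (smashPair (smashPair a b) c) = smashPair a (smashPair b c) := by
  refine (smashDesc_pair _ _ _ _ _ _).trans ?_
  -- Splitting recovers `(a, b)` only when both are non-bottom; otherwise both sides are `⊥`.
  by_cases ha : a = ⊥
  · simp [ha]
  by_cases hb : b = ⊥
  · simp [hb]
  change smashPair (smashSplit _).1 (smashPair (smashSplit _).2 c) = _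
  rw [smashSplit_pair ha hb]

variable (A B D) in
/-- Reassociation from right to left. -/
noncomputable def assocInv : smash A (smash B D) ⟶ smash (smash A B) D :=
  smashDesc (fun (a : A) (x : Smash B D) =>
    smashPair (smashPair a (smashFst B D x)) (smashSnd B D x))
    (smash_continuous (smash_continuous ScottContinuous.fst
      (ScottContinuous.snd.comp (smashFst B D).continuous))
      (ScottContinuous.snd.comp (smashSnd B D).continuous))
    (by simp) (by simp)

lemma assocInv_pair (a : A) (b : B) (c : D) :
    assocInv A B D (smashPair a (smashPair b c)) = smashPair (smashPair a b) c := by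
  refine (smashDesc_pair _ _ _ _ _ _).trans ?_
  by_cases hb : b = ⊥
  · simp [hb]
  by_cases hc : c = ⊥
  · simp [hc]
  change smashPair (smashPair a (smashSplit _).1) (smashSplit _).2 = _
  rw [smashSplit_pair hb hc]

variable (A B) in
/-- The exchange of components. -/
noncomputable def swap : smash A B ⟶ smash B A :=
  smashDesc (fun (a : A) (b : B) => smashPair b a)
    (smash_continuous ScottContinuous.snd ScottContinuous.fst) (by simp) (by simp)

lemma swap_pair (a : A) (b : B) : swap A B (smashPair a b) = smashPair b a :=
  smashDesc_pair _ _ _ _ _ _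

variable (A) in
/-- The left unit law. -/
noncomputable def unitHom : smash sierpinski A ⟶ A :=
  -- The scalar `u` acts as the identity when it is `⊤` and as the constant map `⊥` when it is `⊥`.
  smashDesc (fun u a => liftMap (fun _ => StrictMap.id A) (ScottContinuous.const _) u a)
    (StrictMap.continuous_apply A.isScottDomain
      (ScottContinuous.fst.comp (StrictMap.continuous _)) ScottContinuous.snd) (fun _ => rfl) (by simp)

lemma unitHom_pair (a : A) :
    unitHom A (smashPair (WithBot.some PUnit.unit : WithBot PUnit.{u + 1}) a) = a :=
  smashDesc_pair _ _ _ _ _ _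

variable (A) in
/-- The inverse of the left unit law. -/
noncomputable def unitInv : A ⟶ smash sierpinski A where
  toFun a := smashPair (WithBot.some PUnit.unit) a
  continuous' := smash_continuous (ScottContinuous.const _) ScottContinuous.id
  strict' := by simp

lemma sierpinski_cases (x : sierpinski.{u}) : x = ⊥ ∨ x = WithBot.some PUnit.unit := by
  induction x using WithBot.recBotCoe with
  | bot => exact Or.inl rfl
  | coe x => exact Or.inr rfl

end Maps

/-- The data of the monoidal structure given by the smash product. -/
@[reducible] noncomputable def monoidalStruct : MonoidalCategoryStruct StrictBcdom.{u} where
  tensorObj := smash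
  tensorUnit := sierpinski
  tensorHom := smashMap
  whiskerLeft X _ _ f := smashMap (𝟙 X) f
  whiskerRight f X := smashMap f (𝟙 X)
  associator A B D :=
    { hom := assocHom A B D
      inv := assocInv A B D
      hom_inv_id := hom_ext fun x => by
        obtain ⟨x, c, rfl⟩ := smash_surjective x
        obtain ⟨a, b, rfl⟩ := smash_surjective x
        exact (congrArg (assocInv A B D) (assocHom_pair a b c)).trans (assocInv_pair a b c)
      inv_hom_id := hom_ext fun x => by
        obtain ⟨a, x, rfl⟩ := smash_surjective x
        obtain ⟨b, c, rfl⟩ := smash_surjective x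
        exact (congrArg (assocHom A B D) (assocInv_pair a b c)).trans (assocHom_pair a b c) }
  leftUnitor A :=
    { hom := unitHom A
      inv := unitInv A
      hom_inv_id := hom_ext fun x => by
        obtain ⟨s, a, rfl⟩ := smash_surjective x
        obtain rfl | rfl := sierpinski_cases s
        · rw [smashPair_bot_left]
          exact hom_bot _
        · exact congrArg (unitInv A) (unitHom_pair a)
      inv_hom_id := hom_ext fun a => unitHom_pair a }
  rightUnitor A :=
    { hom := swap A sierpinski ≫ unitHom A
      inv := unitInv A ≫ swap sierpinski A
      hom_inv_id := hom_ext fun x => by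
        obtain ⟨a, s, rfl⟩ := smash_surjective x
        obtain rfl | rfl := sierpinski_cases s
        · rw [smashPair_bot_right]
          exact hom_bot _
        · refine (congrArg (unitHom A ≫ unitInv A ≫ swap sierpinski A) (swap_pair a _)).trans ?_
          refine (congrArg (unitInv A ≫ swap sierpinski A) (unitHom_pair a)).trans ?_
          exact swap_pair _ a
      inv_hom_id := hom_ext fun a =>
        (congrArg (swap A sierpinski ≫ unitHom A)
          (swap_pair (A := sierpinski) (WithBot.some PUnit.unit) a)).trans
          ((congrArg (unitHom A) (swap_pair (B := sierpinski) a (WithBot.some PUnit.unit))).trans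
            (unitHom_pair a)) }

section

attribute [local instance] monoidalStruct

/-- The element `⟨a, b⟩` of the tensor product. -/
noncomputable def pair {A B : StrictBcdom.{u}} (a : A) (b : B) : (A ⊗ B : StrictBcdom.{u}) :=
  smashPair a b

/-- The element `⊤` of the tensor unit. -/
def star : (𝟙_ StrictBcdom.{u} : StrictBcdom.{u}) := WithBot.some PUnit.unit


section Apply

variable {A B D A' B' : StrictBcdom.{u}}

lemma exists_pair (x : (A ⊗ B : StrictBcdom.{u})) : ∃ (a : A) (b : B), x = pair a b :=
  smash_surjective x

lemma unit_cases (x : (𝟙_ StrictBcdom.{u} : StrictBcdom.{u})) : x = ⊥ ∨ x = star :=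
  sierpinski_cases x

@[simp] lemma pair_bot_left (b : B) : pair (⊥ : A) b = ⊥ := smashPair_bot_left b

@[simp] lemma pair_bot_right (a : A) : pair a (⊥ : B) = ⊥ := smashPair_bot_right a

@[simp] lemma tensorHom_pair (f : A ⟶ A') (g : B ⟶ B') (a : A) (b : B) :
    (f ⊗ₘ g) (pair a b) = pair (f a) (g b) := smashMap_pair f g a b

@[simp] lemma whiskerLeft_pair (g : B ⟶ B') (a : A) (b : B) :
    (A ◁ g) (pair a b) = pair a (g b) := smashMap_pair (𝟙 A) g a b

@[simp] lemma whiskerRight_pair (f : A ⟶ A') (a : A) (b : B) :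
    (f ▷ B) (pair a b) = pair (f a) b := smashMap_pair f (𝟙 B) a b

@[simp] lemma associator_hom_pair (a : A) (b : B) (c : D) :
    (α_ A B D).hom (pair (pair a b) c) = pair a (pair b c) := assocHom_pair a b c

@[simp] lemma associator_inv_pair (a : A) (b : B) (c : D) :
    (α_ A B D).inv (pair a (pair b c)) = pair (pair a b) c := assocInv_pair a b c

@[simp] lemma leftUnitor_hom_pair (a : A) : (λ_ A).hom (pair star a) = a := unitHom_pair a

@[simp] lemma leftUnitor_inv_apply (a : A) : (λ_ A).inv a = pair star a := rfl

@[simp] lemma rightUnitor_hom_pair (a : A) : (ρ_ A).hom (pair a star) = a :=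
  (congrArg (unitHom A) (swap_pair (B := sierpinski) a (WithBot.some PUnit.unit))).trans
    (unitHom_pair a)

@[simp] lemma rightUnitor_inv_apply (a : A) : (ρ_ A).inv a = pair a star :=
  swap_pair (A := sierpinski) (WithBot.some PUnit.unit) a

/-- Every element of the smash product is a pair, with `⊥` arising from bottom components. Coherence
laws can thus be verified by evaluating structure maps on pairs. -/
lemma tensor_hom_ext {f g : A ⊗ B ⟶ D} (h : ∀ a b, f (pair a b) = g (pair a b)) : f = g :=
  hom_ext fun x => by
    obtain ⟨a, b, rfl⟩ := exists_pair x
    exact h a b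

lemma unit_hom_ext {f g : 𝟙_ StrictBcdom.{u} ⟶ D} (h : f star = g star) : f = g :=
  hom_ext fun x => by
    obtain rfl | rfl := unit_cases x
    · simp
    · exact h

end Apply

/-- The monoidal structure given by the smash product. -/
@[reducible] noncomputable def monoidalCategory : MonoidalCategory StrictBcdom.{u} :=
  .ofTensorHom
    (id_tensorHom_id := fun _ _ => tensor_hom_ext fun _ _ => by simp)
    (id_tensorHom := fun _ _ _ _ => rfl)
    (tensorHom_id := fun _ _ => rfl)
    (tensorHom_comp_tensorHom := fun _ _ _ _ => tensor_hom_ext fun _ _ => by simp)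
    (associator_naturality := fun _ _ _ => tensor_hom_ext fun x _ => by
      obtain ⟨_, _, rfl⟩ := exists_pair x
      simp)
    (leftUnitor_naturality := fun _ => tensor_hom_ext fun x _ => by
      obtain rfl | rfl := unit_cases x <;> simp)
    (rightUnitor_naturality := fun _ => tensor_hom_ext fun _ x => by
      obtain rfl | rfl := unit_cases x <;> simp)
    (pentagon := fun _ _ _ _ => tensor_hom_ext fun x _ => by
      obtain ⟨x, _, rfl⟩ := exists_pair x
      obtain ⟨_, _, rfl⟩ := exists_pair x
      simp)
    (triangle := fun _ _ => tensor_hom_ext fun x _ => by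
      obtain ⟨_, x, rfl⟩ := exists_pair x
      obtain rfl | rfl := unit_cases x <;> simp)

end

attribute [local instance] monoidalCategory

section Braiding

variable {A B D : StrictBcdom.{u}}

variable (A B) in
/-- The symmetry of the smash product. -/
noncomputable def braid : A ⊗ B ≅ B ⊗ A where
  hom := swap A B
  inv := swap B A
  hom_inv_id := tensor_hom_ext fun a b =>
    (congrArg (swap B A) (swap_pair a b)).trans (swap_pair b a)
  inv_hom_id := tensor_hom_ext fun b a =>
    (congrArg (swap A B) (swap_pair b a)).trans (swap_pair a b)

@[simp] lemma braid_hom_pair (a : A) (b : B) : (braid A B).hom (pair a b) = pair b a :=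
  swap_pair a b

end Braiding

/-- The symmetry of the smash product makes it a symmetric monoidal structure. -/
@[reducible] noncomputable def symmetricCategory : SymmetricCategory StrictBcdom.{u} where
  braiding := braid
  braiding_naturality_right _ _ _ _ := tensor_hom_ext fun _ _ => by simp
  braiding_naturality_left _ _ := tensor_hom_ext fun _ _ => by simp
  hexagon_forward _ _ _ := tensor_hom_ext fun x _ => by
    obtain ⟨_, _, rfl⟩ := exists_pair x
    simp
  hexagon_reverse _ _ _ := tensor_hom_ext fun _ x => by
    obtain ⟨_, _, rfl⟩ := exists_pair x
    simp
  symmetry _ _ := tensor_hom_ext fun _ _ => by simp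

attribute [local instance] symmetricCategory

@[simp] lemma braiding_hom_pair {A B : StrictBcdom.{u}} (a : A) (b : B) :
    (β_ A B).hom (pair a b) = pair b a := braid_hom_pair a b

lemma tensorμ_pair {A B A' B' : StrictBcdom.{u}} (a : A) (a' : A') (b : B) (b' : B') :
    tensorμ A A' B B' (pair (pair a a') (pair b b')) = pair (pair a b) (pair a' b') := by
  simp [tensorμ]

lemma continuous_pair {A B : StrictBcdom.{u}} {X : Type*} [Preorder X] {f : X → A} {g : X → B}
    (hf : ScottContinuous f) (hg : ScottContinuous g) : ScottContinuous fun x => pair (f x) (g x) :=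
  smash_continuous hf hg

/-! ### Strict function spaces as internal homs -/

/-- The domain of strict continuous functions. -/
abbrev homObj (A B : StrictBcdom.{u}) : StrictBcdom.{u} :=
  ⟨StrictMap A B, StrictMap.isScottDomain A.isScottDomain B.isScottDomain⟩

/-- The transpose of a morphism into a strict function space. -/
noncomputable def uncurry {A B D : StrictBcdom.{u}} (g : B ⟶ homObj A D) : smash A B ⟶ D :=
  smashDesc (fun a b => (g b : StrictMap A D) a)
    (StrictMap.continuous_apply D.isScottDomain
      (ScottContinuous.snd.comp (hom_continuous g)) ScottContinuous.fst)
    (fun b => StrictMap.map_bot _) (fun a => by rw [hom_bot]; rfl)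

lemma uncurry_pair {A B D : StrictBcdom.{u}} (g : B ⟶ homObj A D) (a : A) (b : B) :
    uncurry g (pair a b) = (g b : StrictMap A D) a :=
  smashDesc_pair (fun a b => (g b : StrictMap A D) a) _ _ _ a b

/-- The transpose of a morphism out of a tensor product. -/
noncomputable def curry {A B D : StrictBcdom.{u}} (f : A ⊗ B ⟶ D) : B ⟶ homObj A D where
  toFun b :=
    { toFun a := f (pair a b)
      continuous' := (continuous_pair ScottContinuous.id (ScottContinuous.const b)).comp
        (hom_continuous f)
      strict' := by simp }
  continuous' := StrictMap.continuous_of_apply fun a =>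
    (continuous_pair (ScottContinuous.const a) ScottContinuous.id).comp (hom_continuous f)
  strict' := StrictMap.ext_apply fun a => (congrArg f (pair_bot_right a)).trans (hom_bot f)

lemma curry_apply {A B D : StrictBcdom.{u}} (f : A ⊗ B ⟶ D) (b : B) (a : A) :
    (curry f b : StrictMap A D) a = f (pair a b) := rfl

/-- The adjunction between the smash product and the strict function space. -/
noncomputable def homEquiv (A B D : StrictBcdom.{u}) : (A ⊗ B ⟶ D) ≃ (B ⟶ homObj A D) where
  toFun := curry
  invFun := uncurry
  left_inv f := tensor_hom_ext fun a b => uncurry_pair (curry f) a b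
  right_inv g := hom_ext fun b => StrictMap.ext_apply fun a => uncurry_pair g a b

lemma curry_natural {A B B' D : StrictBcdom.{u}} (f : B' ⟶ B) (g : A ⊗ B ⟶ D) :
    curry (A ◁ f ≫ g) = f ≫ curry g :=
  hom_ext fun x => StrictMap.ext_apply fun a => by
    refine (curry_apply _ x a).trans ?_
    rw [ConcreteCategory.comp_apply, whiskerLeft_pair]
    rfl

/-- The smash product has strict function spaces as internal homs. -/
@[reducible] noncomputable def monoidalClosed : MonoidalClosed StrictBcdom.{u} where
  closed A :=
    { rightAdj := Adjunction.rightAdjointOfEquiv (F := tensorLeft A) (G_obj := homObj A)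
        (homEquiv A) fun _ _ _ f g => curry_natural f g
      adj := Adjunction.adjunctionOfEquivRight _ _ }

attribute [local instance] monoidalClosed

/-- The strict continuous function given by an element of the internal hom. -/
def toMap {A B : StrictBcdom.{u}} (f : (ihom A).obj B) : StrictMap A B := f

-- The counit of the adjunction is by construction the transpose of the identity, and `eval`
-- precomposes it with the symmetry.
@[simp] lemma eval_pair {A B : StrictBcdom.{u}} (f : (ihom A).obj B) (a : A) :
    eval A B (pair f a) = toMap f a :=
  (congrArg (uncurry (𝟙 (homObj A B))) (braiding_hom_pair f a)).trans
    (uncurry_pair (𝟙 (homObj A B)) a f)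

end StrictBcdom
/-! ## The lifting comonad -/

namespace StrictBcdom

attribute [local instance] monoidalCategory symmetricCategory monoidalClosed

/-- The lifting of a Scott domain. -/
abbrev bangObj (A : StrictBcdom.{u}) : StrictBcdom.{u} := ⟨WithBot A, A.isScottDomain.withBot⟩

lemma bangObj_hom_ext {A B : StrictBcdom.{u}} {f g : bangObj A ⟶ B}
    (h : ∀ a : A, f (WithBot.some a) = g (WithBot.some a)) : f = g := hom_ext fun x => by
  induction x using WithBot.recBotCoe with
  | bot => exact (hom_bot f).trans (hom_bot g).symm
  | coe x => exact h x

/-- The lifting comonad. -/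
def bangComonad : Comonad StrictBcdom.{u} where
  obj := bangObj
  map f := liftMap (fun a => WithBot.some (f a)) ((hom_continuous f).comp scottContinuous_coe)
  map_id _ := bangObj_hom_ext fun _ => rfl
  map_comp _ _ := bangObj_hom_ext fun _ => rfl
  ε :=
    { app _ := liftMap (fun a => a) ScottContinuous.id
      naturality _ _ _ := bangObj_hom_ext fun _ => rfl }
  δ :=
    { app _ := liftMap (fun a => WithBot.some (WithBot.some a))
        (scottContinuous_coe.comp scottContinuous_coe)
      naturality _ _ _ := bangObj_hom_ext fun _ => rfl }
  coassoc _ := bangObj_hom_ext fun _ => rfl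
  left_counit _ := bangObj_hom_ext fun _ => rfl
  right_counit _ := bangObj_hom_ext fun _ => rfl

/-- The element `up a` of the lifting. -/
def up {A : StrictBcdom.{u}} (a : A) : bangComonad.obj A := WithBot.some a

lemma up_ne_bot {A : StrictBcdom.{u}} (a : A) : up a ≠ ⊥ := WithBot.coe_ne_bot

lemma bang_cases {A : StrictBcdom.{u}} (x : bangComonad.obj A) : x = ⊥ ∨ ∃ a : A, x = up a := by
  induction x using WithBot.recBotCoe with
  | bot => exact Or.inl rfl
  | coe x => exact Or.inr ⟨x, rfl⟩

lemma continuous_up {A : StrictBcdom.{u}} {X : Type*} [Preorder X] {f : X → A}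
    (hf : ScottContinuous f) : ScottContinuous fun x => up (f x) :=
  hf.comp scottContinuous_coe

/-- The strict extension of a continuous function to the lifting. -/
def bangDesc {A B : StrictBcdom.{u}} (f : A → B) (hf : ScottContinuous f) : bangComonad.obj A ⟶ B :=
  liftMap f hf

lemma bang_hom_ext {A B : StrictBcdom.{u}} {f g : bangComonad.obj A ⟶ B}
    (h : ∀ a, f (up a) = g (up a)) : f = g := bangObj_hom_ext h

variable {A B D : StrictBcdom.{u}}

@[simp] lemma bang_map_up (f : A ⟶ B) (a : A) : bangComonad.map f (up a) = up (f a) := rfl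

@[simp] lemma bang_ε_up (a : A) : bangComonad.ε.app A (up a) = a := rfl

@[simp] lemma bang_δ_up (a : A) : bangComonad.δ.app A (up a) = up (up a) := rfl

/-- The structure map `q_𝟙`. -/
noncomputable def bangUnit : 𝟙_ StrictBcdom.{u} ⟶ bangComonad.obj (𝟙_ StrictBcdom.{u}) :=
  -- The Sierpinski domain is by definition the lifting of the one-point domain.
  bangDesc (A := ⟨PUnit.{u + 1}, isScottDomain_punit⟩) (fun _ => up star) (ScottContinuous.const _)

@[simp] lemma bangUnit_star : bangUnit star.{u} = up star := rfl

variable (A B) in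
/-- The structure map `q_{A,B}`. -/
noncomputable def bangTensor : bangComonad.obj A ⊗ bangComonad.obj B ⟶ bangComonad.obj (A ⊗ B) :=
  -- Currying lets each argument be treated in turn as the source of a map out of a lifting.
  uncurry (D := bangComonad.obj (A ⊗ B)) <|
    bangDesc (B := homObj (bangComonad.obj A) (bangComonad.obj (A ⊗ B)))
    (fun b => bangDesc (fun a => up (pair a b))
      (continuous_up (continuous_pair ScottContinuous.id (ScottContinuous.const b))))
    (StrictMap.continuous_of_apply fun x => by
      obtain rfl | ⟨a, rfl⟩ := bang_cases x
      · exact ScottContinuous.const ⊥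
      · exact continuous_up (continuous_pair (ScottContinuous.const a) ScottContinuous.id))

@[simp] lemma bangTensor_up (a : A) (b : B) :
    bangTensor A B (pair (up a) (up b)) = up (pair a b) := uncurry_pair _ (up a) (up b)

lemma bang_tensor_hom_ext {f g : bangComonad.obj A ⊗ bangComonad.obj B ⟶ D}
    (h : ∀ a b, f (pair (up a) (up b)) = g (pair (up a) (up b))) : f = g :=
  tensor_hom_ext fun x y => by
    obtain rfl | ⟨a, rfl⟩ := bang_cases x
    · simp
    obtain rfl | ⟨b, rfl⟩ := bang_cases y
    · simp
    exact h a b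

/-- Lifting is a symmetric monoidal functor. -/
@[reducible] noncomputable def bangLax : (bangComonad.{u}).toFunctor.LaxBraided where
  ε := bangUnit
  μ := bangTensor
  μ_natural_left _ _ := bang_tensor_hom_ext fun _ _ => by simp
  μ_natural_right _ _ := bang_tensor_hom_ext fun _ _ => by simp
  associativity _ _ _ := tensor_hom_ext fun x z => by
    obtain ⟨x, y, rfl⟩ := exists_pair x
    obtain rfl | ⟨a, rfl⟩ := bang_cases x
    · simp
    obtain rfl | ⟨b, rfl⟩ := bang_cases y
    · simp
    obtain rfl | ⟨c, rfl⟩ := bang_cases z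
    · simp
    simp
  left_unitality _ := tensor_hom_ext fun x y => by
    obtain rfl | rfl := unit_cases x
    · simp
    obtain rfl | ⟨b, rfl⟩ := bang_cases y
    · simp
    simp
  right_unitality _ := tensor_hom_ext fun x y => by
    obtain rfl | rfl := unit_cases y
    · simp
    obtain rfl | ⟨b, rfl⟩ := bang_cases x
    · simp
    simp
  braided _ _ := bang_tensor_hom_ext fun _ _ => by simp

section

attribute [local instance] bangLax

lemma bangComonad_ε_isMonoidal : NatTrans.IsMonoidal (bangComonad.{u}).ε where
  unit := unit_hom_ext rfl
  tensor X Y := bang_tensor_hom_ext fun a b =>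
    (congrArg (bangComonad.ε.app (X ⊗ Y)) (bangTensor_up a b)).trans
      (tensorHom_pair (bangComonad.ε.app X) (bangComonad.ε.app Y) (up a) (up b)).symm

lemma bangComonad_δ_isMonoidal : NatTrans.IsMonoidal (bangComonad.{u}).δ where
  unit := unit_hom_ext rfl
  tensor X Y := bang_tensor_hom_ext fun a b =>
    (congrArg (bangComonad.δ.app (X ⊗ Y)) (bangTensor_up a b)).trans <| Eq.symm <|
      (congrArg (bangTensor _ _ ≫ bangComonad.map (bangTensor X Y))
        (tensorHom_pair (bangComonad.δ.app X) (bangComonad.δ.app Y) (up a) (up b))).trans <|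
      (congrArg (bangComonad.map (bangTensor X Y)) (bangTensor_up (up a) (up b))).trans <|
      congrArg up (bangTensor_up a b)

end

/-! ### Comonoids -/

lemma star_ne_bot : star.{u} ≠ ⊥ := WithBot.coe_ne_bot

variable (A) in
/-- The morphism to the tensor unit sending all elements other than `⊥` to `⊤`. -/
noncomputable def erase : A ⟶ 𝟙_ StrictBcdom.{u} := discard A

lemma erase_of_ne_bot {a : A} (ha : a ≠ ⊥) : erase A a = star := discard_of_ne_bot ha

@[simp] lemma erase_up (a : A) : erase (bangComonad.obj A) (up a) = star :=
  erase_of_ne_bot (up_ne_bot a)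

variable (A) in
/-- The diagonal. -/
noncomputable def diag : A ⟶ A ⊗ A where
  toFun a := pair a a
  continuous' := continuous_pair ScottContinuous.id ScottContinuous.id
  strict' := pair_bot_left _

@[simp] lemma diag_apply (a : A) : diag A a = pair a a := rfl

variable (A) in
/-- The diagonal comonoid. -/
@[reducible] noncomputable def diagComon : ComonObj A where
  counit := erase A
  comul := diag A
  counit_comul := hom_ext fun a => by
    by_cases ha : a = ⊥
    · simp [ha]
    · simp [erase_of_ne_bot ha]
  comul_counit := hom_ext fun a => by
    by_cases ha : a = ⊥
    · simp [ha]
    · simp [erase_of_ne_bot ha]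
  comul_assoc := hom_ext fun _ => by simp

lemma diagComon_comm (A : StrictBcdom.{u}) :
    letI := diagComon A
    IsCommComonObj A :=
  letI := diagComon A
  { comul_comm := hom_ext fun _ => by simp [ComonObj.comul] }

/-- The morphisms of diagonal comonoids are those that reflect `⊥`. -/
lemma diagComon_isComonHom (f : A ⟶ B) (hf : ∀ a, f a = ⊥ → a = ⊥) :
    letI := diagComon A
    letI := diagComon B
    IsComonHom f :=
  letI := diagComon A
  letI := diagComon B
  -- Reflection of `⊥` serves the counit alone; the diagonal is respected by every strict map.
  { hom_counit := hom_ext fun a => by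
      by_cases ha : a = ⊥
      · simp [ha]
      · simp [ComonObj.counit, erase_of_ne_bot ha, erase_of_ne_bot (mt (hf a) ha)]
    hom_comul := hom_ext fun _ => by simp [ComonObj.comul] }

end StrictBcdom

/-! ### The linear category structure -/

open StrictBcdom

attribute [local instance] monoidalCategory symmetricCategory monoidalClosed

/-- The linear category of Scott domains and strict continuous functions. -/
@[reducible] noncomputable def linearCategory : LinearCategory StrictBcdom.{u} where
  bang := bangComonad
  lax := bangLax
  ε_monoidal := bangComonad_ε_isMonoidal
  δ_monoidal := bangComonad_δ_isMonoidal
  comon A := diagComon (bangComonad.obj A)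
  comm A := diagComon_comm (bangComonad.obj A)
  d_natural f := bang_hom_ext fun _ => by simp [ComonObj.comul]
  e_natural f := bang_hom_ext fun _ => by simp [ComonObj.counit]
  d_unit := unit_hom_ext (by simp [ComonObj.comul, Functor.LaxMonoidal.ε])
  d_tensor A B := bang_tensor_hom_ext fun _ _ => by
    simp [ComonObj.comul, Functor.LaxMonoidal.μ, tensorμ_pair]
  e_unit := unit_hom_ext (by simp [ComonObj.counit, Functor.LaxMonoidal.ε])
  e_tensor A B := bang_tensor_hom_ext fun _ _ => by
    simp [ComonObj.counit, Functor.LaxMonoidal.μ]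
  d_coalgebra A := bang_hom_ext fun a =>
    ((congrArg (bangTensor (bangComonad.obj A) (bangComonad.obj A))
      (tensorHom_pair (bangComonad.δ.app A) (bangComonad.δ.app A) (up a) (up a))).trans
        (bangTensor_up (up a) (up a))).symm
  e_coalgebra A := bang_hom_ext fun a =>
    (congrArg up (erase_up a)).trans (congrArg bangUnit (erase_up a)).symm
  comonHom_of_coalgebraHom f h := diagComon_isComonHom f fun x hx => by
    obtain rfl | ⟨a, rfl⟩ := bang_cases x
    · rfl
    -- If `f (up a) = ⊥`, the coalgebra equation at `up a` has a lifted element, `up (f (up a))`, on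
    -- the left and `δ ⊥ = ⊥` on the right.
    · have := ConcreteCategory.congr_hom h (up a)
      simp only [ConcreteCategory.comp_apply, bang_δ_up, hx, hom_bot] at this
      exact absurd this (up_ne_bot _)

/-! ## Products, natural numbers and fixpoints -/

namespace StrictBcdom

/-- The cartesian product of Scott domains. -/
abbrev prodObj (A B : StrictBcdom.{u}) : StrictBcdom.{u} :=
  ⟨A × B, A.isScottDomain.prod B.isScottDomain⟩

/-- The terminal Scott domain. -/
abbrev terminalObj : StrictBcdom.{u} := ⟨PUnit.{u + 1}, isScottDomain_punit⟩

variable {A B D : StrictBcdom.{u}}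

/-- The first projection. -/
def prodFst (A B : StrictBcdom.{u}) : prodObj A B ⟶ A := ⟨Prod.fst, ScottContinuous.fst, rfl⟩

/-- The second projection. -/
def prodSnd (A B : StrictBcdom.{u}) : prodObj A B ⟶ B := ⟨Prod.snd, ScottContinuous.snd, rfl⟩

/-- The pairing of two morphisms. -/
def prodLift (f : D ⟶ A) (g : D ⟶ B) : D ⟶ prodObj A B where
  toFun x := (f x, g x)
  continuous' := (hom_continuous f).prodMk (hom_continuous g)
  strict' := Prod.ext (hom_bot f) (hom_bot g)

/-- The cartesian product as a binary fan. -/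
abbrev prodFan (A B : StrictBcdom.{u}) : Limits.BinaryFan A B :=
  Limits.BinaryFan.mk (prodFst A B) (prodSnd A B)

/-- The cartesian product is a categorical product. -/
def prodFanIsLimit (A B : StrictBcdom.{u}) : Limits.IsLimit (prodFan A B) :=
  Limits.BinaryFan.IsLimit.mk _ prodLift (fun _ _ => rfl) (fun _ _ => rfl)
    fun _ _ _ hf hg => hom_ext fun x =>
      Prod.ext (ConcreteCategory.congr_hom hf x) (ConcreteCategory.congr_hom hg x)

/-- The one-point domain is terminal. -/
def terminalObjIsTerminal : Limits.IsTerminal terminalObj.{u} :=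
  Limits.IsTerminal.ofUniqueHom (fun _ => ⟨fun _ => PUnit.unit, ScottContinuous.const _, rfl⟩)
    fun _ _ => hom_ext fun _ => rfl

/-! ### The co-Kleisli category -/

/-- A co-Kleisli morphism is a strict map out of a lifting, that is, a continuous function that need
not be strict. Products and exponentials are accordingly those of Scott domains with all continuous
functions. -/
lemma cokleisli_hom_ext {X Y : Cokleisli bangComonad.{u}} {f g : X ⟶ Y}
    (h : ∀ x : X.of, f.of (up x) = g.of (up x)) : f = g :=
  Cokleisli.hom_ext (U := bangComonad) (bang_hom_ext h)

/-- Binary products in the co-Kleisli category. -/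
def cokleisliProd (X Y : Cokleisli bangComonad.{u}) : Limits.LimitCone (Limits.pair X Y) where
  cone := Limits.BinaryFan.mk (P := Cokleisli.mk bangComonad (prodObj X.of Y.of))
    (.mk (bangComonad.ε.app _ ≫ prodFst X.of Y.of)) (.mk (bangComonad.ε.app _ ≫ prodSnd X.of Y.of))
  isLimit := Limits.BinaryFan.IsLimit.mk _ (fun f g => .mk (prodLift f.of g.of))
    (fun _ _ => cokleisli_hom_ext fun _ => rfl) (fun _ _ => cokleisli_hom_ext fun _ => rfl)
    fun _ _ _ hf hg => cokleisli_hom_ext fun x =>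
      Prod.ext (ConcreteCategory.congr_hom (congrArg Cokleisli.Hom.of hf) (up x))
        (ConcreteCategory.congr_hom (congrArg Cokleisli.Hom.of hg) (up x))

/-- The terminal object of the co-Kleisli category. -/
def cokleisliTerminal : Limits.LimitCone (Functor.empty.{0} (Cokleisli bangComonad.{u})) where
  cone := Limits.asEmptyCone (Cokleisli.mk bangComonad terminalObj)
  isLimit := Limits.IsTerminal.ofUniqueHom (fun _ => .mk (terminalObjIsTerminal.from _))
    fun _ _ => cokleisli_hom_ext fun _ => rfl

/-- The co-Kleisli category of the lifting comonad is cartesian. -/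
@[reducible] def cokleisliCartesian : CartesianMonoidalCategory (Cokleisli bangComonad.{u}) :=
  .ofChosenFiniteProducts cokleisliTerminal cokleisliProd

attribute [local instance] cokleisliCartesian

/-- Currying in the co-Kleisli category. -/
def cokleisliCurry {X Y Z : Cokleisli bangComonad.{u}} (f : X ⊗ Y ⟶ Z) :
    Y ⟶ Cokleisli.mk bangComonad (homObj (bangComonad.obj X.of) Z.of) :=
  .mk <| bangDesc
    (fun y : Y.of => bangDesc (fun x : X.of => f.of (up (A := prodObj X.of Y.of) (x, y)))
      ((continuous_up (A := prodObj X.of Y.of)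
        (ScottContinuous.id.prodMk (ScottContinuous.const y))).comp (hom_continuous f.of)))
    (StrictMap.continuous_of_apply fun x => by
      obtain rfl | ⟨a, rfl⟩ := bang_cases x
      · exact ScottContinuous.const ⊥
      · exact (continuous_up (A := prodObj X.of Y.of)
          ((ScottContinuous.const a).prodMk ScottContinuous.id)).comp (hom_continuous f.of))

/-- Uncurrying in the co-Kleisli category. -/
def cokleisliUncurry {X Y Z : Cokleisli bangComonad.{u}}
    (g : Y ⟶ Cokleisli.mk bangComonad (homObj (bangComonad.obj X.of) Z.of)) : X ⊗ Y ⟶ Z :=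
  .mk <| bangDesc (A := prodObj X.of Y.of)
    (fun p : X.of × Y.of => (g.of (up p.2) : StrictMap (bangComonad.obj X.of) Z.of) (up p.1))
    (StrictMap.continuous_apply Z.of.isScottDomain
      ((continuous_up ScottContinuous.snd).comp (hom_continuous g.of))
      (continuous_up ScottContinuous.fst))

/-- The exponential adjunction of the co-Kleisli category. -/
def cokleisliEquiv (X Y Z : Cokleisli bangComonad.{u}) :
    (X ⊗ Y ⟶ Z) ≃ (Y ⟶ Cokleisli.mk bangComonad (homObj (bangComonad.obj X.of) Z.of)) where
  toFun := cokleisliCurry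
  invFun := cokleisliUncurry
  left_inv _ := cokleisli_hom_ext fun _ => rfl
  -- Elements of `!X ⊸ Z` must also be compared at `⊥`, where strictness decides.
  right_inv g := cokleisli_hom_ext fun y => StrictMap.ext_apply fun x => by
    obtain rfl | ⟨a, rfl⟩ := bang_cases x
    · exact (StrictMap.map_bot _).trans (StrictMap.map_bot _).symm
    · rfl

lemma cokleisliCurry_natural {X Y Y' Z : Cokleisli bangComonad.{u}} (f : Y' ⟶ Y) (g : X ⊗ Y ⟶ Z) :
    cokleisliCurry (X ◁ f ≫ g) = f ≫ cokleisliCurry g :=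
  cokleisli_hom_ext fun y => StrictMap.ext_apply fun x => by
    obtain rfl | ⟨a, rfl⟩ := bang_cases x
    · exact (StrictMap.map_bot _).trans (StrictMap.map_bot _).symm
    · rfl

/-- The co-Kleisli category of the lifting comonad is cartesian closed. -/
@[reducible] def cokleisliClosed : MonoidalClosed (Cokleisli bangComonad.{u}) where
  closed X :=
    { rightAdj := Adjunction.rightAdjointOfEquiv (F := tensorLeft X)
        (G_obj := fun Z => Cokleisli.mk bangComonad (homObj (bangComonad.obj X.of) Z.of))
        (cokleisliEquiv X) fun _ _ _ f g => cokleisliCurry_natural f g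
      adj := Adjunction.adjunctionOfEquivRight _ _ }

/-! ### Natural numbers -/

/-- The flat domain of natural numbers. -/
def natObj : StrictBcdom.{u} := ⟨ULift.{u} FlatNat, FlatNat.isScottDomain⟩

/-- The natural number `n` as an element of the flat domain. -/
def ofNat (n : ℕ) : natObj.{u} := ULift.up (FlatNat.nat n)

lemma ofNat_ne_bot (n : ℕ) : ofNat.{u} n ≠ ⊥ := fun h => by
  have : FlatNat.nat n = FlatNat.bot := congrArg ULift.down h
  cases this

lemma nat_cases (x : natObj.{u}) : x = ⊥ ∨ ∃ n, x = ofNat n := by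
  obtain ⟨_ | n⟩ := x
  exacts [Or.inl rfl, Or.inr ⟨n, rfl⟩]

/-- The morphism out of the flat natural numbers given by a sequence. -/
def natDesc (f : ℕ → A) : natObj ⟶ A :=
  flatMap (fun x => match x.down with
    | .bot => ⊥
    | .nat n => f n) rfl

@[simp] lemma natDesc_ofNat (f : ℕ → A) (n : ℕ) : natDesc f (ofNat n) = f n := rfl

lemma nat_hom_ext {f g : natObj ⟶ A} (h : ∀ n, f (ofNat n) = g (ofNat n)) : f = g :=
  hom_ext fun x => by
    obtain rfl | ⟨n, rfl⟩ := nat_cases x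
    · simp
    · exact h n

/-- The coalgebra of natural numbers. -/
@[reducible] def natCoalgebra : (bangComonad.{u}).Coalgebra where
  A := natObj
  a := natDesc fun n => up (ofNat n)
  counit := nat_hom_ext fun _ => rfl
  coassoc := nat_hom_ext fun _ => rfl

/-- The morphism from the tensor unit selecting an element. -/
noncomputable def point (a : A) : 𝟙_ StrictBcdom.{u} ⟶ A :=
  liftMap (fun _ => a) (ScottContinuous.const a)

/-- The successor. -/
def natSucc : natObj.{u} ⟶ natObj.{u} := natDesc fun n => ofNat (n + 1)

/-- The predecessor. -/
def natPred : natObj.{u} ⟶ natObj.{u} := natDesc fun n => ofNat (n - 1)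

/-- With `unit_hom_ext`, this turns laws about numerals as morphisms into computations in the flat
domain. -/
lemma numeral_star (n : ℕ) : numeral (point (ofNat.{u} 0)) natSucc n star = ofNat n := by
  induction n with
  | zero => rfl
  | succ n ih => exact (congrArg natSucc ih).trans (natDesc_ofNat _ n)

/-- The conditional. -/
noncomputable def natCond : natObj.{u} ⊗ prodObj natObj.{u} natObj.{u} ⟶ natObj.{u} :=
  -- The conditional is the transpose of the sequence of projections that has the first projection
  -- at `0` and the second at every `n + 1`. The symmetry brings the number into the curried
  -- position.
  (braid natObj (prodObj natObj natObj)).hom ≫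
    uncurry (natDesc (A := homObj (prodObj natObj natObj) natObj) fun n =>
      if n = 0 then prodFst natObj natObj else prodSnd natObj natObj)

lemma natCond_pair (n : ℕ) (p : prodObj natObj.{u} natObj.{u}) :
    natCond (pair (ofNat n) p) = if n = 0 then p.1 else p.2 := by
  refine (congrArg (uncurry _) (braid_hom_pair (ofNat n) p)).trans ((uncurry_pair _ _ _).trans ?_)
  rw [natDesc_ofNat]
  split_ifs <;> rfl

/-! ### Fixpoints -/

/-- The fixpoint operators. -/
noncomputable def fixMap (B : StrictBcdom.{u}) :
    bangComonad.obj ((ihom (bangComonad.obj B)).obj B) ⟶ B :=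
  bangDesc (fun f => lfp B.isScottDomain (toMap f)) (continuous_lfp B.isScottDomain)

lemma isLeast_fixMap (f : (ihom (bangComonad.obj B)).obj B) :
    IsLeast {b : B | toMap f (up b) = b} (fixMap B (up f)) :=
  isLeast_lfp B.isScottDomain (toMap f)

end StrictBcdom

-- Assembly of the `Sℓλ`-structure

attribute [local instance] linearCategory

/-- The `Sℓλ`-category of Scott domains and strict continuous functions. -/
@[reducible] noncomputable def slLambdaCategory : SlLambdaCategory StrictBcdom.{u} where
  num := natCoalgebra
  zero := point (ofNat 0)
  succ := natSucc
  pred := natPred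
  -- Truncated subtraction makes the predecessor of `0` equal to `0`, a value on which the law is
  -- silent.
  numeral_pred n := unit_hom_ext <| (congrArg natPred (numeral_star (n + 1))).trans <|
    (natDesc_ofNat _ (n + 1)).trans (numeral_star n).symm
  numComon := diagComon natObj
  numComm := diagComon_comm natObj
  zero_coalgebra := unit_hom_ext rfl
  succ_coalgebra := nat_hom_ext fun _ => rfl
  zero_comon :=
    letI := ComonObj.instTensorUnit StrictBcdom.{u}
    letI := diagComon natObj.{u}
    { hom_counit := unit_hom_ext (erase_of_ne_bot (ofNat_ne_bot 0))
      hom_comul := unit_hom_ext (tensorHom_pair (point (ofNat 0)) (point (ofNat 0)) star star).symm }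
  succ_comon := diagComon_isComonHom natSucc fun x hx => by
    obtain rfl | ⟨n, rfl⟩ := nat_cases x
    · rfl
    · exact absurd hx (ofNat_ne_bot (n + 1))
  p_comon := diagComon_isComonHom natCoalgebra.a fun x hx => by
    obtain rfl | ⟨n, rfl⟩ := nat_cases x
    · rfl
    · exact absurd hx (up_ne_bot (ofNat n))
  fan := prodFan
  fanIsLimit := prodFanIsLimit
  top := terminalObj
  topIsTerminal := terminalObjIsTerminal
  lif := natCond
  lif_zero f g := unit_hom_ext <| (congrArg natCond (tensorHom_pair
    (numeral (point (ofNat 0)) natSucc 0) (prodLift f g) star star)).trans <| by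
      rw [numeral_star]
      exact natCond_pair 0 _
  lif_succ n f g := unit_hom_ext <| (congrArg natCond (tensorHom_pair
    (numeral (point (ofNat 0)) natSucc (n + 1)) (prodLift f g) star star)).trans <| by
      rw [numeral_star]
      exact natCond_pair (n + 1) _
  kleisli_cartesianClosed := ⟨cokleisliCartesian, ⟨cokleisliClosed⟩⟩
  fix := fixMap
  -- At `up f` the right-hand side evaluates to `f (up (fix (up f)))`, so the law is exactly the
  -- fixed point equation.
  fix_eq B := bang_hom_ext fun f => Eq.symm <|
    (congrArg (eval (bangComonad.obj B) B) (tensorHom_pair (bangComonad.ε.app _)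
      (bangComonad.δ.app _ ≫ bangComonad.map (fixMap B)) (up f) (up f))).trans <|
    (eval_pair f (up (fixMap B (up f)))).trans (isLeast_fixMap f).1

/-- The identification of the structure with the concrete domains. -/
def carriers :
    letI := slLambdaCategory.{u}
    Carriers.{u} :=
  letI := slLambdaCategory.{u}
  { tensor := fun A B => OrderIso.refl (Smash A B)
    unit :=
      { toFun := WithBot.recBotCoe false fun _ => true
        invFun := fun b => if b then WithBot.some PUnit.unit else (⊥ : WithBot PUnit)
        left_inv := fun x => by
          obtain rfl | rfl := sierpinski_cases x <;> rfl
        right_inv := by rintro (_ | _) <;> rfl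
        map_rel_iff' := fun {x y} => by
          obtain rfl | rfl := sierpinski_cases x <;> obtain rfl | rfl := sierpinski_cases y
          · exact iff_of_true le_rfl le_rfl
          · exact iff_of_true bot_le bot_le
          · exact iff_of_false (by decide) (fun h => star_ne_bot (le_bot_iff.1 h))
          · exact iff_of_true le_rfl le_rfl }
    hom := fun A B => OrderIso.refl (StrictMap A B)
    lift := fun A => OrderIso.refl (WithBot A)
    prod := fun A B => OrderIso.refl (A × B)
    nat :=
      { toEquiv := Equiv.ulift
        map_rel_iff' := Iff.rfl } }

end SlLambda

open SlLambda LinearCategory SlLambdaCategory in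
/-- The category of Scott domains and strict continuous functions is an `Sℓλ`-category, with the
smash product, the Sierpinski domain, strict function spaces, lifting, the flat natural numbers,
and the operations described by the formulas below. All maps being strict, their values at the
remaining element `⊥` are `⊥`. -/
theorem mainTheorem3 :
    ∃ (_ : MonoidalCategory StrictBcdom.{u}) (_ : SymmetricCategory StrictBcdom.{u})
      (_ : MonoidalClosed StrictBcdom.{u}) (_ : LinearCategory StrictBcdom.{u})
      (_ : SlLambdaCategory StrictBcdom.{u}) (K : Carriers.{u}),
      -- the symmetric monoidal structure
      (∀ {A A' B B' : StrictBcdom.{u}} (f : A ⟶ A') (g : B ⟶ B') (a : A) (b : B),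
        (f ⊗ₘ g) (K.pair a b) = K.pair (f a) (g b)) ∧
      (∀ {A B D : StrictBcdom.{u}} (a : A) (b : B) (c : D),
        (α_ A B D).hom (K.pair (K.pair a b) c) = K.pair a (K.pair b c)) ∧
      (∀ {A : StrictBcdom.{u}} (a : A), (λ_ A).hom (K.pair K.star a) = a) ∧
      (∀ {A : StrictBcdom.{u}} (a : A), (ρ_ A).hom (K.pair a K.star) = a) ∧
      (∀ {A B : StrictBcdom.{u}} (a : A) (b : B), (β_ A B).hom (K.pair a b) = K.pair b a) ∧
      -- evaluation
      (∀ {A B : StrictBcdom.{u}} (f : (ihom A).obj B) (a : A),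
        (eval A B) (K.pair f a) = K.hom A B f a) ∧
      -- the lifting comonad with its monoidal and comonoid structure
      (∀ {A B : StrictBcdom.{u}} (f : A ⟶ B) (a : A), (bang.map f) (K.up a) = K.up (f a)) ∧
      (∀ {A : StrictBcdom.{u}} (a : A), (bang.ε.app A) (K.up a) = a) ∧
      (∀ {A : StrictBcdom.{u}} (a : A), (bang.δ.app A) (K.up a) = K.up (K.up a)) ∧
      (Functor.LaxMonoidal.ε (bang (C := StrictBcdom.{u})).toFunctor) K.star = K.up K.star ∧
      (∀ {A B : StrictBcdom.{u}} (a : A) (b : B),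
        (Functor.LaxMonoidal.μ bang.toFunctor A B) (K.pair (K.up a) (K.up b)) =
          K.up (K.pair a b)) ∧
      (∀ {A : StrictBcdom.{u}} (a : A),
        (ComonObj.comul (X := bang.obj A)) (K.up a) = K.pair (K.up a) (K.up a)) ∧
      (∀ {A : StrictBcdom.{u}} (a : A), (ComonObj.counit (X := bang.obj A)) (K.up a) = K.star) ∧
      -- cartesian products
      (∀ {A B : StrictBcdom.{u}} (a : A) (b : B), (fan A B).fst (K.couple a b) = a) ∧
      (∀ {A B : StrictBcdom.{u}} (a : A) (b : B), (fan A B).snd (K.couple a b) = b) ∧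
      -- the flat natural numbers, with `p`, `w_N` and `c_N`
      (zero (C := StrictBcdom.{u})) K.star = K.ofNat 0 ∧
      (∀ n : ℕ, (succ (C := StrictBcdom.{u})) (K.ofNat n) = K.ofNat (n + 1)) ∧
      (∀ n : ℕ, (pred (C := StrictBcdom.{u})) (K.ofNat (n + 1)) = K.ofNat n) ∧
      (∀ n : ℕ, (num (C := StrictBcdom.{u})).a (K.ofNat n) = K.up (K.ofNat n)) ∧
      (∀ n : ℕ, (ComonObj.counit (X := (num (C := StrictBcdom.{u})).A)) (K.ofNat n) = K.star) ∧
      (∀ n : ℕ,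
        (ComonObj.comul (X := (num (C := StrictBcdom.{u})).A)) (K.ofNat n) = K.pair (K.ofNat n) (K.ofNat n)) ∧
      -- the conditional
      (∀ m₁ m₂ : (num (C := StrictBcdom.{u})).A,
        (lif (C := StrictBcdom.{u})) (K.pair (K.ofNat 0) (K.couple m₁ m₂)) = m₁) ∧
      (∀ (n : ℕ) (m₁ m₂ : (num (C := StrictBcdom.{u})).A),
        (lif (C := StrictBcdom.{u})) (K.pair (K.ofNat (n + 1)) (K.couple m₁ m₂)) = m₂) ∧
      -- the fixpoint operators compute least fixed points
      (∀ {B : StrictBcdom.{u}} (f : (ihom (bang.obj B)).obj B),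
        IsLeast {b : B | K.hom (bang.obj B) B f (K.up b) = b} (fix B (K.up f))) := by
  open StrictBcdom in
  refine ⟨monoidalCategory, symmetricCategory, monoidalClosed, linearCategory, slLambdaCategory,
    carriers, ?_⟩
  -- All identifications in `carriers` are identities, apart from those of `𝟙` with `Bool` and of
  -- `N` with its unlifted copy. Each formula thus unfolds to a computation with the concrete maps.
  open StrictBcdom in
  refine ⟨fun f g a b => tensorHom_pair f g a b, fun a b c => associator_hom_pair a b c,
    fun a => leftUnitor_hom_pair a, fun a => rightUnitor_hom_pair a,
    fun a b => braiding_hom_pair a b, fun f a => eval_pair f a, fun f a => bang_map_up f a,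
    fun a => bang_ε_up a, fun a => bang_δ_up a, bangUnit_star, fun a b => bangTensor_up a b,
    fun a => diag_apply (up a), fun a => erase_up a, fun _ _ => rfl, fun _ _ => rfl, rfl,
    fun _ => rfl, fun _ => rfl, fun _ => rfl, fun n => erase_of_ne_bot (ofNat_ne_bot n),
    fun _ => rfl, fun m₁ m₂ => natCond_pair 0 (m₁, m₂),
    fun n m₁ m₂ => natCond_pair (n + 1) (m₁, m₂),
    fun f => isLeast_fixMap f⟩
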